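/- **Theorem (Concentration inequalities for control neighbor estimates).** Let $d\ge 1$ be an integer and let $\mu$ be a probability measure on $\mathbb R^d$ that is supported by a compact set $M$ and has a density $f$ with respect to Lebesgue measure $\lambda_d$. Assume that there are constants $b,U,c,r_0\in(0,\infty)$, $b\le U$, such that $b\le f(x)\le U$ for all $x\in M$, and $\lambda_d(M\cap B(x,r))\ge c\,\lambda_d(B(x,r))$ for all $x\in M$ and $r\in(0,r_0]$, where $B(x,r)$ is the closed Euclidean ball. Let $X_1,X_2,\ldots$ be independent random variables with common law $\mu$, and let $\varphi$ satisfy $|\varphi(x)-\varphi(y)|\le L\|x-y\|^s$ for all $x,y\in M$, where $s\in(0,1]$ and $L>0$. For $n\ge2$ let $\hat N_n(x)$ be the nearest neighbor of $x$ among $X_1,\ldots,X_n$ and $\hat N_n^{(i)}(x)$ the nearest neighbor of $x$ among these points without $X_i$ (ties are broken by the smallest index), and put $\hat\varphi_n=\varphi\circ\hat N_n$, $\hat\varphi_n^{(i)}=\varphi\circ\hat N_n^{(i)}$, $\mu(g)=\int g\,d\mu$. Define $$\hat\mu_n^{\mathrm{(NN)}}(\varphi)=\frac1n\sum_{i=1}^n\Big[\varphi(X_i)-\big\{\hat\varphi_n^{(i)}(X_i)-\mu(\hat\varphi_n)\big\}\Big],\qquad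 \hat\mu_n^{\mathrm{(NN\text{-}loo)}}(\varphi)=\frac1n\sum_{i=1}^n\Big[\varphi(X_i)-\big\{\hat\varphi_n^{(i)}(X_i)-\mu(\hat\varphi_n^{(i)})\big\}\Big].$$ Let $C_\varphi=\frac12\{\sup_M\varphi-\inf_M\varphi\}$, let $V_d$ be the volume of the unit ball of $\mathbb R^d$, and, for $\varepsilon\in(0,1)$, let $$\Delta_{n,\varepsilon}=\frac{\sqrt{\log(2/\sqrt\varepsilon)}+n^{-s/d}}{n^{1/2+s/d}}\cdot\begin{cases}\log(24n/\varepsilon)^{1+s/d}&\text{if }\varepsilon\le 2n^{-1/2-s/d},\\(3\log(3n))^{1+s/d}&\text{if }\varepsilon>2n^{-1/2-s/d}.\end{cases}$$ For $K_1,K_2>0$ consider the statement that, with probability at least $1-\varepsilon$, $$\big|\hat\mu_n^{\mathrm{(NN\text{-}loo)}}(\varphi)-\mu(\varphi)\big|\le K_1\Delta_{n,\varepsilon}+\frac{6C_\varphi}{n^{1/2+s/d}}\quad\text{and}\quad \big|\hat\mu_n^{\mathrm{(NN)}}(\varphi)-\mu(\varphi)\big|\le K_2\Delta_{n,\varepsilon}+\frac{6C_\varphi}{n^{1/2+s/d}}+\frac{(s/d+2)L(V_dbc)^{-s/d}}{n^{1+s/d}}.\tag{$*$}$$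 (a) There are $K_1,K_2>0$ that depend only on $(b,c,d,L,s,U)$ such that $(*)$ holds for all $n\ge2$ and $\varepsilon\in(0,1)$ with $8d\log(12n/\delta_n)\le r_0^d\,n\,b\,c\,V_d/2$, where $\delta_n=\min(\varepsilon/2,\,n^{-1/2-s/d})$. (b) There are $K_1,K_2>0$ that depend only on $(b,c,d,L,s,U)$ and on the ratio $\operatorname{diam}(M)/r_0$ such that $(*)$ holds for all $n\ge2$ and all $\varepsilon\in(0,1)$. -/

import Mathlib

open MeasureTheory ProbabilityTheory

noncomputable section

/-- The index of the nearest neighbor of `x` among the points `X j`, `j ∈ I`: the smallest index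
in `I` at which the distance to `x` is minimal. (Meaningful when `I` is non-empty.) -/
def nnIndex {E : Type*} [MetricSpace E] (X : ℕ → E) (I : Finset ℕ) (x : E) : ℕ :=
  sInf {j : ℕ | j ∈ I ∧ ∀ k ∈ I, dist x (X j) ≤ dist x (X k)}

/-- The nearest neighbor of `x` in the sample `X 0, …, X (n - 1)`. -/
def nearest {E : Type*} [MetricSpace E] (X : ℕ → E) (n : ℕ) (x : E) : E :=
  X (nnIndex X (Finset.range n) x)

/-- The leave-one-out nearest neighbor of `x`: the nearest neighbor of `x` in the sample
`X 0, …, X (n - 1)` with the `i`-th observation removed. -/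
def nearestLoo {E : Type*} [MetricSpace E] (X : ℕ → E) (n i : ℕ) (x : E) : E :=
  X (nnIndex X ((Finset.range n).erase i) x)

/-- The control neighbor estimate
`(1/n) ∑ᵢ [φ(Xᵢ) - (φ̂ₙ⁽ⁱ⁾(Xᵢ) - μ(φ̂ₙ))]`, where `φ̂ₙ = φ ∘ N̂ₙ` and `φ̂ₙ⁽ⁱ⁾ = φ ∘ N̂ₙ⁽ⁱ⁾`. -/
def estimateNN {E : Type*} [MetricSpace E] [MeasurableSpace E]
    (μ : Measure E) (φ : E → ℝ) (X : ℕ → E) (n : ℕ) : ℝ :=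
  (1 / (n : ℝ)) * ∑ i ∈ Finset.range n,
    (φ (X i) - (φ (nearestLoo X n i (X i)) - ∫ x, φ (nearest X n x) ∂μ))

/-- The leave-one-out control neighbor estimate
`(1/n) ∑ᵢ [φ(Xᵢ) - (φ̂ₙ⁽ⁱ⁾(Xᵢ) - μ(φ̂ₙ⁽ⁱ⁾))]`. -/
def estimateLoo {E : Type*} [MetricSpace E] [MeasurableSpace E]
    (μ : Measure E) (φ : E → ℝ) (X : ℕ → E) (n : ℕ) : ℝ :=
  (1 / (n : ℝ)) * ∑ i ∈ Finset.range n,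
    (φ (X i) - (φ (nearestLoo X n i (X i)) - ∫ x, φ (nearestLoo X n i x) ∂μ))

/-- The volume of the unit ball of `ℝ^d`. -/
def unitBallVolume (d : ℕ) : ℝ :=
  (volume (Metric.closedBall (0 : EuclideanSpace ℝ (Fin d)) 1)).toReal

/-- `μ` is supported by the compact set `M`, has the density `f` with respect to Lebesgue measure,
`b ≤ f ≤ U` on `M`, and `M` fills at least the proportion `c` of each ball that is centered
in `M` and has radius at most `r₀`. -/
structure HasRegularDensity {d : ℕ} (μ : Measure (EuclideanSpace ℝ (Fin d)))
    (M : Set (EuclideanSpace ℝ (Fin d))) (f : EuclideanSpace ℝ (Fin d) → ℝ)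
    (b U c r₀ : ℝ) : Prop where
  isCompact : IsCompact M
  null_compl : μ Mᶜ = 0
  measurable : Measurable f
  nonneg : ∀ x, 0 ≤ f x
  eq_withDensity : μ = volume.withDensity (fun x => ENNReal.ofReal (f x))
  lower : ∀ x ∈ M, b ≤ f x
  upper : ∀ x ∈ M, f x ≤ U
  regular : ∀ r : ℝ, 0 < r → r ≤ r₀ → ∀ x ∈ M,
    ENNReal.ofReal c * volume (Metric.closedBall x r) ≤ volume (M ∩ Metric.closedBall x r)

/-- Half the range of `φ` on `M`. -/
def halfRange {E : Type*} (φ : E → ℝ) (M : Set E) : ℝ :=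
  (1 / 2) * (sSup (φ '' M) - sInf (φ '' M))

/-- The deviation term `Δ_{n,ε}`. -/
def deviation (d n : ℕ) (s ε : ℝ) : ℝ :=
  (Real.sqrt (Real.log (2 / Real.sqrt ε)) + 1 / (n : ℝ) ^ (s / (d : ℝ)))
      / (n : ℝ) ^ (1 / 2 + s / (d : ℝ)) *
    (if ε ≤ 2 / (n : ℝ) ^ (1 / 2 + s / (d : ℝ)) then
      Real.log (24 * (n : ℝ) / ε) ^ (1 + s / (d : ℝ))
    else
      (3 * Real.log (3 * (n : ℝ))) ^ (1 + s / (d : ℝ)))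

/-- The event that the errors of both control neighbor estimates obey the claimed bounds with the
constants `K₁` (leave-one-out) and `K₂` (non-leave-one-out). The points `ω ↦ X i ω` are the
sample. -/
def deviationEvent {Ω : Type*} {d : ℕ} (μ : Measure (EuclideanSpace ℝ (Fin d)))
    (M : Set (EuclideanSpace ℝ (Fin d))) (φ : EuclideanSpace ℝ (Fin d) → ℝ)
    (X : ℕ → Ω → EuclideanSpace ℝ (Fin d)) (b c L s : ℝ) (n : ℕ) (ε K₁ K₂ : ℝ) : Set Ω :=
  {ω | |estimateLoo μ φ (fun i => X i ω) n - ∫ x, φ x ∂μ|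
          ≤ K₁ * deviation d n s ε
            + 6 * halfRange φ M / (n : ℝ) ^ (1 / 2 + s / (d : ℝ)) ∧
       |estimateNN μ φ (fun i => X i ω) n - ∫ x, φ x ∂μ|
          ≤ K₂ * deviation d n s ε
            + 6 * halfRange φ M / (n : ℝ) ^ (1 / 2 + s / (d : ℝ))
            + (s / (d : ℝ) + 2) * L * (unitBallVolume d * b * c) ^ (-(s / (d : ℝ)))
              / (n : ℝ) ^ (1 + s / (d : ℝ))}

end

/-! The error of the leave-one-out estimate is the average over `i` of the integral of `x ↦ φ(N⁽ⁱ⁾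
x) - φ x` minus the value of the same function at `X i`. Since `N⁽ⁱ⁾` ignores `X i`, every summand
is centered. Nearest neighbors are typically at distance `n^(-1/d)`, so the summands have size
`n^(-s/d)`. Replacing one observation should then move the average by about `n^(-1-s/d)`, and
McDiarmid's inequality yields the rate `n^(-1/2-s/d)`, up to logarithms.

Bounded differences must hold for every sample, whereas nearest neighbors are close only with high
probability. The increments are therefore cut off at a radius `r` with `r^d` of order `ℓ/n`, where
`ℓ = log(12n/δ)`. The truncated error is still exactly centered (`integral_truncError`), and its
differences are controlled deterministically (`abs_truncError_sub_erase_le`). The control comes from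
the size `D = L r^s` of an increment, the mass `m` of a ball of radius `r`, and a packing constant
`κ` bounding how many distinct points can share a nearest neighbor (`exists_card_nearest_le`).

Undoing the truncation costs little: with high probability no sample point is isolated, and the
points that are remote from the sample have mass at most `n^(-1/2-s/d)`. This mass times the
oscillation of `φ` gives the `C_φ` term. The other estimate differs from the leave-one-out one by a
quantity with an additional factor `1/n` (`abs_estimateNN_sub_estimateLoo_le`).

The lower bound on ball masses needs `r ≤ r₀`, which is the hypothesis of (a). When it fails, `r₀^d`
is at most of order `ℓ/n`, and so is `diam(M)^d` once the ratio `diam(M)/r₀` is fixed; the almost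
sure bound on the error by the oscillation of `φ` is then enough. -/

/-! ### McDiarmid's inequality -/

lemma integrable_of_measurable_of_abs_le {α : Type*} [MeasurableSpace α] {ν : Measure α}
    [IsFiniteMeasure ν] {g : α → ℝ} (hg : Measurable g) {B : ℝ} (hB : ∀ a, |g a| ≤ B) :
    Integrable g ν :=
  Integrable.of_bound hg.aestronglyMeasurable B (Filter.Eventually.of_forall hB)

lemma abs_integral_le_of_abs_le {α : Type*} [MeasurableSpace α] {ν : Measure α}
    [IsProbabilityMeasure ν] {g : α → ℝ} {B : ℝ} (hB : ∀ a, |g a| ≤ B) :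
    |∫ a, g a ∂ν| ≤ B := by
  have := norm_integral_le_of_norm_le_const (μ := ν) (f := g) (C := B)
    (Filter.Eventually.of_forall hB)
  simpa using this

/-- Hoeffding's lemma for a function whose oscillation is at most `c`. -/
lemma integral_exp_le_of_oscillation {E : Type*} [MeasurableSpace E] {ν : Measure E}
    [IsProbabilityMeasure ν] {h : E → ℝ} (hm : Measurable h) {c : ℝ}
    (hosc : ∀ x y, |h x - h y| ≤ c) (t : ℝ) :
    ∫ x, Real.exp (t * (h x - ∫ y, h y ∂ν)) ∂ν ≤ Real.exp (c ^ 2 * t ^ 2 / 2) := by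
  obtain ⟨x₀⟩ := nonempty_of_isProbabilityMeasure ν
  -- Centering at one value gives an interval of length `2 * c` rather than `c`. The exponent is
  -- four times the optimal one, which affects only constants.
  have hI : ∀ᵐ x ∂ν, h x ∈ Set.Icc (h x₀ - c) (h x₀ + c) := by
    refine Filter.Eventually.of_forall fun x => ?_
    have := abs_le.1 (hosc x x₀)
    constructor <;> linarith
  have hc : 0 ≤ c := (abs_nonneg _).trans (hosc x₀ x₀)
  have := (hasSubgaussianMGF_of_mem_Icc hm.aemeasurable hI).mgf_le t
  refine this.trans (le_of_eq ?_)
  congr 1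
  have : (h x₀ + c - (h x₀ - c)) = 2 * c := by ring
  rw [this]
  simp only [NNReal.coe_pow, NNReal.coe_div, coe_nnnorm, Real.norm_eq_abs, NNReal.coe_ofNat]
  rw [div_pow, sq_abs]; ring

/-- The moment generating function bound behind McDiarmid's bounded difference inequality. -/
lemma integral_exp_le_of_bounded_differences {E : Type*} [MeasurableSpace E] {ν : Measure E}
    [IsProbabilityMeasure ν] {c : ℝ} (t : ℝ) (n : ℕ) :
    ∀ f : (Fin n → E) → ℝ, Measurable f → (∃ B, ∀ z, |f z| ≤ B) →
      (∀ z j y, |f (Function.update z j y) - f z| ≤ c) →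
      ∫ z, Real.exp (t * (f z - ∫ z, f z ∂Measure.pi fun _ => ν)) ∂(Measure.pi fun _ => ν)
        ≤ Real.exp (n * c ^ 2 * t ^ 2 / 2) := by
  induction n with
  | zero =>
    intro f _ _ _
    have hconst : ∀ z, f z = f default := fun z => by congr 1; exact Subsingleton.elim _ _
    simp only [hconst]
    simp
  | succ n ih =>
    intro f hf hB hd
    obtain ⟨B, hB⟩ := hB
    set π := Measure.pi fun _ : Fin n => ν
    let e := MeasurableEquiv.piFinSuccAbove (fun _ : Fin (n + 1) => E) 0
    have he : MeasurePreserving e (Measure.pi fun _ => ν) (ν.prod π) :=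
      measurePreserving_piFinSuccAbove (fun _ : Fin (n + 1) => ν) 0
    let k : E × (Fin n → E) → ℝ := fun p => f (e.symm p)
    have hk : Measurable k := hf.comp e.symm.measurable
    have hkB : ∀ p, |k p| ≤ B := fun p => hB _
    have transfer : ∀ φ : ℝ → ℝ, ∫ z, φ (f z) ∂(Measure.pi fun _ => ν)
        = ∫ p, φ (k p) ∂(ν.prod π) := by
      intro φ
      rw [← he.integral_comp' (fun p => φ (k p))]
      simp [k]
    have hsymm : ∀ y z, e.symm (y, z) = Fin.cons y z := by
      intro y z
      simp [e, MeasurableEquiv.piFinSuccAbove]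
      rfl
    -- Averaging out coordinate 0 preserves the bounded differences in the others, so the induction
    -- hypothesis applies to `g`. The fluctuation around `g` in coordinate 0 costs one Hoeffding
    -- factor.
    let g : (Fin n → E) → ℝ := fun z => ∫ y, k (y, z) ∂ν
    have hg : Measurable g := by
      have : StronglyMeasurable (fun z => ∫ y, k (y, z) ∂ν) :=
        hk.stronglyMeasurable.integral_prod_left'
      exact this.measurable
    have hgB : ∀ z, |g z| ≤ B := fun z => abs_integral_le_of_abs_le fun y => hkB _
    have hki : ∀ z, Integrable (fun y => k (y, z)) ν := fun z =>
      integrable_of_measurable_of_abs_le (hk.comp measurable_prodMk_right) fun y => hkB _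
    have hgd : ∀ z j y, |g (Function.update z j y) - g z| ≤ c := by
      intro z j y
      change |∫ x, k (x, Function.update z j y) ∂ν - ∫ x, k (x, z) ∂ν| ≤ c
      rw [← integral_sub (hki _) (hki _)]
      refine abs_integral_le_of_abs_le fun x => ?_
      simp only [k, hsymm]
      rw [Fin.cons_update]
      exact hd _ _ _
    have hosc : ∀ z x y, |k (x, z) - k (y, z)| ≤ c := by
      intro z x y
      simp only [k, hsymm]
      have := hd (Fin.cons y z) 0 x
      rwa [Fin.update_cons_zero] at this
    set m := ∫ z, f z ∂(Measure.pi fun _ => ν) with hm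
    have hmg : m = ∫ z, g z ∂π := by
      rw [hm, transfer (fun x => x), integral_prod_symm]
      exact integrable_of_measurable_of_abs_le hk hkB
    have hexpB : ∀ {α : Type _} (u : α → ℝ) (a : ℝ), (∀ x, |u x| ≤ B) →
        ∀ x, |Real.exp (t * (u x - a))| ≤ Real.exp (|t| * (B + |a|)) := by
      intro α u a hu x
      rw [abs_of_pos (Real.exp_pos _)]
      refine Real.exp_le_exp.2 ((le_abs_self _).trans ?_)
      rw [abs_mul]
      gcongr
      exact (abs_sub _ _).trans (by gcongr; exact hu x)
    rw [transfer (fun x => Real.exp (t * (x - m))), integral_prod_symm _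
      (integrable_of_measurable_of_abs_le (by fun_prop) (hexpB k m hkB))]
    have inner : ∀ z, ∫ y, Real.exp (t * (k (y, z) - m)) ∂ν
        ≤ Real.exp (t * (g z - m)) * Real.exp (c ^ 2 * t ^ 2 / 2) := by
      intro z
      have h1 : ∀ y, Real.exp (t * (k (y, z) - m))
          = Real.exp (t * (g z - m)) * Real.exp (t * (k (y, z) - g z)) := by
        intro y; rw [← Real.exp_add]; ring_nf
      simp only [h1]
      rw [integral_const_mul]
      gcongr
      exact integral_exp_le_of_oscillation (hk.comp measurable_prodMk_right) (hosc z) t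
    calc ∫ z, ∫ y, Real.exp (t * (k (y, z) - m)) ∂ν ∂π
        ≤ ∫ z, Real.exp (t * (g z - m)) * Real.exp (c ^ 2 * t ^ 2 / 2) ∂π := by
          refine integral_mono ?_ ?_ inner
          · exact (integrable_of_measurable_of_abs_le (ν := ν.prod π)
              (by fun_prop) (hexpB k m hkB)).integral_prod_right
          · exact (integrable_of_measurable_of_abs_le (by fun_prop) (hexpB g m hgB)).mul_const _
      _ = (∫ z, Real.exp (t * (g z - ∫ z, g z ∂π)) ∂π) * Real.exp (c ^ 2 * t ^ 2 / 2) := by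
          rw [integral_mul_const, hmg]
      _ ≤ Real.exp (n * c ^ 2 * t ^ 2 / 2) * Real.exp (c ^ 2 * t ^ 2 / 2) := by
          gcongr
          exact ih g hg ⟨B, hgB⟩ hgd
      _ = _ := by
          rw [← Real.exp_add]; push_cast; ring_nf

/-- McDiarmid's bounded difference inequality, two-sided and with a non-optimal constant. -/
lemma measure_abs_ge_le_of_bounded_differences {E : Type*} [MeasurableSpace E] {ν : Measure E}
    [IsProbabilityMeasure ν] {c : ℝ} {n : ℕ} {f : (Fin n → E) → ℝ} (hf : Measurable f)
    {B : ℝ} (hB : ∀ z, |f z| ≤ B) (hd : ∀ z j y, |f (Function.update z j y) - f z| ≤ c)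
    (h0 : ∫ z, f z ∂(Measure.pi fun _ => ν) = 0) {a : ℝ} (ha : 0 ≤ a) :
    (Measure.pi fun _ => ν).real {z | a ≤ |f z|}
      ≤ 2 * Real.exp (-a ^ 2 / (2 * (n * c ^ 2))) := by
  have hsub : HasSubgaussianMGF f (n * ‖c‖₊ ^ 2) (Measure.pi fun _ => ν) := by
    refine ⟨fun t => ?_, fun t => ?_⟩
    · refine integrable_of_measurable_of_abs_le (B := Real.exp (|t| * B)) (by fun_prop) fun z => ?_
      rw [abs_of_pos (Real.exp_pos _)]
      refine Real.exp_le_exp.2 ((le_abs_self _).trans ?_)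
      rw [abs_mul]
      gcongr
      exact hB z
    · have := integral_exp_le_of_bounded_differences (ν := ν) t n f hf ⟨B, hB⟩ hd
      rw [h0] at this
      simp only [sub_zero] at this
      simpa [mgf] using this
  have h1 := hsub.measure_ge_le ha
  have h2 := hsub.neg.measure_ge_le ha
  have hset : {z | a ≤ |f z|} ⊆ {z | a ≤ f z} ∪ {z | a ≤ (-f) z} := by
    intro z hz
    simp only [Set.mem_ofPred_eq] at hz
    rcases le_abs.1 hz with h | h
    · exact Or.inl h
    · exact Or.inr h
  have hcast : ((n * ‖c‖₊ ^ 2 : NNReal) : ℝ) = n * c ^ 2 := by simp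
  rw [hcast] at h1 h2
  calc _ ≤ _ := measureReal_mono hset
    _ ≤ _ := measureReal_union_le _ _
    _ ≤ _ := by linarith

/-! ### Resampling one observation -/

/-- Replacing a coordinate of an i.i.d. sample by an independent copy preserves the law. -/
lemma measurePreserving_update {E : Type*} [MeasurableSpace E] (ν : Measure E)
    [IsProbabilityMeasure ν] {n : ℕ} (i : Fin n) :
    MeasurePreserving (fun p : E × (Fin n → E) => Function.update p.2 i p.1)
      (ν.prod (Measure.pi fun _ => ν)) (Measure.pi fun _ => ν) := by
  have hmeas : Measurable (fun p : E × (Fin n → E) => Function.update p.2 i p.1) := by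
    refine measurable_pi_iff.2 fun k => ?_
    by_cases h : k = i
    · subst h; simpa using measurable_fst
    · simp only [Function.update_of_ne h]; fun_prop
  refine ⟨hmeas, (Measure.pi_eq fun s hs => ?_).symm⟩
  rw [Measure.map_apply hmeas (MeasurableSet.univ_pi hs)]
  have hset : (fun p : E × (Fin n → E) => Function.update p.2 i p.1) ⁻¹' Set.univ.pi s
      = s i ×ˢ Set.univ.pi (Function.update s i Set.univ) := by
    ext ⟨x, z⟩
    simp only [Set.mem_preimage, Set.mem_pi, Set.mem_univ, true_implies, Set.mem_prod]
    constructor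
    · intro h
      refine ⟨by simpa using h i, fun k => ?_⟩
      by_cases hk : k = i
      · subst hk; simp
      · simpa [Function.update_of_ne hk] using h k
    · rintro ⟨h1, h2⟩ k
      by_cases hk : k = i
      · subst hk; simpa using h1
      · simpa [Function.update_of_ne hk] using h2 k
  rw [hset, Measure.prod_prod, Measure.pi_pi, ← Finset.mul_prod_erase Finset.univ _
    (Finset.mem_univ i), ← Finset.mul_prod_erase Finset.univ (fun k => ν (s k))
    (Finset.mem_univ i)]
  simp only [Function.update_self, measure_univ, one_mul]
  congr 1
  refine Finset.prod_congr rfl fun k hk => ?_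
  rw [Function.update_of_ne (Finset.ne_of_mem_erase hk)]

/-- As `H x` does not see coordinate `i`, that coordinate is a fresh point independent of `H`. This
is the source of the centering of the truncated error. -/
lemma integral_resample {E : Type*} [MeasurableSpace E] {ν : Measure E}
    [IsProbabilityMeasure ν] {n : ℕ} (i : Fin n) {H : E → (Fin n → E) → ℝ}
    (hH : Measurable (Function.uncurry H)) {B : ℝ} (hB : ∀ x z, |H x z| ≤ B)
    (hi : ∀ x z y, H x (Function.update z i y) = H x z) :
    ∫ z, H (z i) z ∂(Measure.pi fun _ => ν) = ∫ z, ∫ x, H x z ∂ν ∂(Measure.pi fun _ => ν) := by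
  have hm : Measurable fun z : Fin n → E => H (z i) z :=
    hH.comp (f := fun z : Fin n → E => (z i, z)) ((measurable_pi_apply i).prodMk measurable_id)
  rw [← (measurePreserving_update ν i).map_eq, integral_map
    (measurePreserving_update ν i).measurable.aemeasurable hm.aestronglyMeasurable,
    (measurePreserving_update ν i).map_eq]
  simp only [Function.update_self, hi]
  rw [integral_prod_symm]
  exact integrable_of_measurable_of_abs_le hH fun p => hB _ _

/-! ### Nearest neighbor indices: deletion and measurability -/

section NearestIndex

variable {E : Type*} [MetricSpace E]

lemma nnIndex_mem_and_dist_le (X : ℕ → E) {I : Finset ℕ} (hI : I.Nonempty) (x : E) :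
    nnIndex X I x ∈ I ∧ ∀ k ∈ I, dist x (X (nnIndex X I x)) ≤ dist x (X k) := by
  obtain ⟨j, hj, hmin⟩ := I.exists_min_image (fun k => dist x (X k)) hI
  exact Nat.sInf_mem (s := {j : ℕ | j ∈ I ∧ ∀ k ∈ I, dist x (X j) ≤ dist x (X k)}) ⟨j, hj, hmin⟩

lemma nnIndex_mem (X : ℕ → E) {I : Finset ℕ} (hI : I.Nonempty) (x : E) : nnIndex X I x ∈ I :=
  (nnIndex_mem_and_dist_le X hI x).1

lemma dist_nnIndex_le (X : ℕ → E) {I : Finset ℕ} (x : E) {k : ℕ} (hk : k ∈ I) :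
    dist x (X (nnIndex X I x)) ≤ dist x (X k) :=
  (nnIndex_mem_and_dist_le X ⟨k, hk⟩ x).2 k hk

lemma nnIndex_le_of_minimal {X : ℕ → E} {I : Finset ℕ} {x : E} {j : ℕ} (hj : j ∈ I)
    (hmin : ∀ k ∈ I, dist x (X j) ≤ dist x (X k)) : nnIndex X I x ≤ j :=
  Nat.sInf_le ⟨hj, hmin⟩

lemma nnIndex_congr {X Y : ℕ → E} {I : Finset ℕ} (h : ∀ k ∈ I, X k = Y k) (x : E) :
    nnIndex X I x = nnIndex Y I x := by
  unfold nnIndex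
  congr 1
  ext j
  simp only [Set.mem_ofPred_eq]
  refine and_congr_right fun hj => forall₂_congr fun k hk => ?_
  rw [h j hj, h k hk]

/-- Removing a point that is not selected changes neither the minimal distance nor the outcome of
the tie-break. The analysis of the influence of one observation rests on this. -/
lemma nnIndex_erase {X : ℕ → E} {I : Finset ℕ} (hI : I.Nonempty) {x : E} {j : ℕ}
    (hj : nnIndex X I x ≠ j) : nnIndex X (I.erase j) x = nnIndex X I x := by
  obtain ⟨hm, hmin⟩ := nnIndex_mem_and_dist_le X hI x
  have hm' : nnIndex X I x ∈ I.erase j := Finset.mem_erase.2 ⟨hj, hm⟩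
  obtain ⟨hk, hkmin⟩ := nnIndex_mem_and_dist_le X ⟨_, hm'⟩ x
  refine le_antisymm (nnIndex_le_of_minimal hm' fun k hk => hmin k (Finset.mem_of_mem_erase hk)) ?_
  exact nnIndex_le_of_minimal (Finset.mem_of_mem_erase hk)
    fun k hk' => (hkmin _ hm').trans (hmin k hk')

/-- The strict inequality for earlier indices encodes the tie-break. In this form the event is a
finite combination of comparisons of distances, hence measurable. -/
lemma nnIndex_eq_iff {X : ℕ → E} {I : Finset ℕ} (hI : I.Nonempty) {x : E} {j : ℕ} :
    nnIndex X I x = j ↔ j ∈ I ∧ ∀ k ∈ I, dist x (X j) ≤ dist x (X k) ∧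
      (k < j → dist x (X j) < dist x (X k)) := by
  obtain ⟨hm, hmin⟩ := nnIndex_mem_and_dist_le X hI x
  constructor
  · rintro rfl
    refine ⟨hm, fun k hk => ⟨hmin k hk, fun hlt => ?_⟩⟩
    by_contra hle
    exact absurd (nnIndex_le_of_minimal hk fun l hl => (not_lt.1 hle).trans (hmin l hl))
      (not_le.2 hlt)
  · rintro ⟨hj, h⟩
    refine le_antisymm (nnIndex_le_of_minimal hj fun k hk => (h k hk).1) ?_
    by_contra hlt
    exact absurd ((h _ hm).2 (not_le.1 hlt)) (not_lt.2 (hmin j hj))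

lemma measurable_nnIndex [MeasurableSpace E] [BorelSpace E] [SecondCountableTopology E]
    {α : Type*} [MeasurableSpace α] {X : α → ℕ → E} (hX : ∀ k, Measurable fun a => X a k)
    {x : α → E} (hx : Measurable x) (I : Finset ℕ) :
    Measurable fun a => nnIndex (X a) I (x a) := by
  rcases I.eq_empty_or_nonempty with rfl | hI
  · simp [nnIndex]
  refine measurable_to_countable' fun j => ?_
  have : (fun a => nnIndex (X a) I (x a)) ⁻¹' {j} = {_a : α | j ∈ I} ∩
      ⋂ k ∈ I, ({a | dist (x a) (X a j) ≤ dist (x a) (X a k)} ∩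
        {a | k < j → dist (x a) (X a j) < dist (x a) (X a k)}) := by
    ext a
    simp only [Set.mem_preimage, Set.mem_singleton_iff, Set.mem_ofPred_eq, Set.mem_inter_iff,
      Set.mem_iInter]
    exact nnIndex_eq_iff hI
  rw [this]
  have hd : ∀ k, Measurable fun a => dist (x a) (X a k) := fun k => hx.dist (hX k)
  refine (MeasurableSet.const _).inter ?_
  refine Finset.measurableSet_biInter _ fun k _ => (measurableSet_le (hd j) (hd k)).inter ?_
  by_cases hkj : k < j
  · simpa [hkj] using measurableSet_lt (hd j) (hd k)
  · simp [hkj]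

lemma measurable_apply_nnIndex [MeasurableSpace E] [BorelSpace E] [SecondCountableTopology E]
    {α : Type*} [MeasurableSpace α] {X : α → ℕ → E} (hX : ∀ k, Measurable fun a => X a k)
    {x : α → E} (hx : Measurable x) (I : Finset ℕ) :
    Measurable fun a => X a (nnIndex (X a) I (x a)) := by
  have h : Measurable fun p : ℕ × α => X p.2 p.1 := measurable_from_prod_countable_right hX
  exact h.comp (f := fun a => (nnIndex (X a) I (x a), a))
    ((measurable_nnIndex hX hx I).prodMk measurable_id)

end NearestIndex

/-! ### Packing: how many points share a nearest neighbor -/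

/-- Two nonzero vectors whose directions are at distance less than one: the longer one is closer
to the shorter one than to the origin. -/
lemma norm_sub_lt_of_norm_direction_sub_lt {E : Type*} [NormedAddCommGroup E] [NormedSpace ℝ E]
    {a b : E} (ha : a ≠ 0) (hab : ‖a‖ ≤ ‖b‖) (h : ‖‖b‖⁻¹ • b - ‖a‖⁻¹ • a‖ < 1) :
    ‖b - a‖ < ‖b‖ := by
  have ha' : 0 < ‖a‖ := norm_pos_iff.2 ha
  have hb' : 0 < ‖b‖ := ha'.trans_le hab
  -- Shorten `b` to the length of `a`, then turn its direction: the first move has length `‖b‖ -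
  -- ‖a‖`, the second less than `‖a‖`.
  have e : b - a = (‖b‖ - ‖a‖) • (‖b‖⁻¹ • b) + ‖a‖ • (‖b‖⁻¹ • b - ‖a‖⁻¹ • a) := by
    rw [smul_sub, sub_smul, smul_inv_smul₀ hb'.ne', smul_inv_smul₀ ha'.ne']
    abel
  have h1 : ‖(‖b‖ - ‖a‖) • (‖b‖⁻¹ • b)‖ = ‖b‖ - ‖a‖ := by
    rw [norm_smul, norm_smul, norm_inv, norm_norm, inv_mul_cancel₀ hb'.ne', mul_one,
      Real.norm_eq_abs, abs_of_nonneg (sub_nonneg.2 hab)]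
  have h2 : ‖‖a‖ • (‖b‖⁻¹ • b - ‖a‖⁻¹ • a)‖ < ‖a‖ := by
    rw [norm_smul, norm_norm]
    exact mul_lt_of_lt_one_right ha' h
  calc ‖b - a‖ ≤ _ := e ▸ norm_add_le _ _
    _ < ‖b‖ := by rw [h1]; linarith

/-- A sample point is the nearest neighbor of a bounded number of other, distinct points. -/
lemma exists_card_nearest_le (E : Type*) [NormedAddCommGroup E] [NormedSpace ℝ E] [ProperSpace E] :
    ∃ κ : ℕ, ∀ (X : ℕ → E) (I : Finset ℕ) (j : ℕ) (S : Finset ℕ),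
      (∀ i ∈ S, i ∈ I ∧ X i ≠ X j ∧ nnIndex X (I.erase i) (X i) = j) → S.card ≤ κ := by
  classical
  -- Two directions in the same ball of radius 1/2 are at distance less than one. The number of
  -- balls depends only on the space.
  obtain ⟨t, -, htf, hcover⟩ := (isCompact_sphere (0 : E) 1).finite_cover_balls
    (e := 1 / 2) (by norm_num)
  refine ⟨htf.toFinset.card, fun X I j S hS => ?_⟩
  have hdir : ∀ i ∈ S, ∃ u ∈ t, dist (‖X i - X j‖⁻¹ • (X i - X j)) u < 1 / 2 := by
    intro i hi
    have hne : X i - X j ≠ 0 := sub_ne_zero.2 (hS i hi).2.1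
    have : ‖X i - X j‖⁻¹ • (X i - X j) ∈ Metric.sphere (0 : E) 1 := by
      rw [mem_sphere_zero_iff_norm, norm_smul, norm_inv, norm_norm,
        inv_mul_cancel₀ (norm_ne_zero_iff.2 hne)]
    obtain ⟨u, hu, hd⟩ := Set.mem_iUnion₂.1 (hcover this)
    exact ⟨u, hu, Metric.mem_ball.1 hd⟩
  choose! u hut hu using hdir
  -- If two points lie in the same direction from `X j`, the farther one is strictly closer to the
  -- other than to `X j`, so `X j` is not its nearest neighbor.
  have key : ∀ i ∈ S, ∀ k ∈ S, u i = u k → ‖X i - X j‖ ≤ ‖X k - X j‖ → i = k := by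
    intro i hi k hk huik hle
    by_contra hik
    have h1 : ‖‖X k - X j‖⁻¹ • (X k - X j) - ‖X i - X j‖⁻¹ • (X i - X j)‖ < 1 := by
      rw [← dist_eq_norm]
      have := dist_triangle_right (‖X k - X j‖⁻¹ • (X k - X j)) (‖X i - X j‖⁻¹ • (X i - X j)) (u k)
      have h2 := hu k hk
      have h3 := hu i hi
      rw [huik] at h3
      linarith
    have h2 := norm_sub_lt_of_norm_direction_sub_lt (sub_ne_zero.2 (hS i hi).2.1) hle h1
    rw [sub_sub_sub_cancel_right, ← dist_eq_norm, ← dist_eq_norm] at h2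
    have h3 := dist_nnIndex_le X (X k) (Finset.mem_erase.2 ⟨hik, (hS i hi).1⟩)
    rw [(hS k hk).2.2] at h3
    exact absurd h2 (not_lt.2 h3)
  refine Finset.card_le_card_of_injOn u (fun i hi => ?_) (fun i hi k hk huik => ?_)
  · simpa using hut i hi
  · rcases le_total ‖X i - X j‖ ‖X k - X j‖ with h | h
    · exact key i hi k hk huik h
    · exact (key k hk i hi huik.symm h).symm

/-! ### Truncated increments -/

noncomputable section

open Classical in
/-- The increment of `φ` from `x` to `y`, cut off unless both points lie in `M` at distance at most
`r`. -/
def truncDiff {E : Type*} [MetricSpace E] (φ : E → ℝ) (M : Set E) (r : ℝ) (x y : E) : ℝ :=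
  if x ∈ M ∧ y ∈ M ∧ dist x y ≤ r then φ y - φ x else 0

open Classical in
/-- The truncated increment of `φ` from `x` to its nearest neighbor among `X i`, `i ∈ I`. -/
def nnDiff {E : Type*} [MetricSpace E] (φ : E → ℝ) (M : Set E) (r : ℝ) (X : ℕ → E)
    (I : Finset ℕ) (x : E) : ℝ :=
  if I.Nonempty then truncDiff φ M r x (X (nnIndex X I x)) else 0

/-- The error of the leave-one-out estimate with all increments of `φ` truncated. -/
def truncError {E : Type*} [MetricSpace E] [MeasurableSpace E] (μ : Measure E) (φ : E → ℝ)
    (M : Set E) (r : ℝ) (n : ℕ) (X : ℕ → E) : ℝ :=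
  (1 / (n : ℝ)) * ∑ i ∈ Finset.range n,
    ((∫ x, nnDiff φ M r X ((Finset.range n).erase i) x ∂μ)
      - nnDiff φ M r X ((Finset.range n).erase i) (X i))

end

section Truncated

variable {E : Type*} [MetricSpace E] {φ : E → ℝ} {M : Set E} {r : ℝ}

lemma truncDiff_self (x : E) : truncDiff φ M r x x = 0 := by simp [truncDiff]

lemma truncDiff_of_lt {x y : E} (h : r < dist x y) : truncDiff φ M r x y = 0 := by
  simp [truncDiff, not_le.2 h]

lemma nnDiff_congr {X Y : ℕ → E} {I : Finset ℕ} (h : ∀ k ∈ I, X k = Y k) (x : E) :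
    nnDiff φ M r X I x = nnDiff φ M r Y I x := by
  unfold nnDiff
  split_ifs with hI
  · rw [nnIndex_congr h, h _ (nnIndex_mem Y hI x)]
  · rfl

lemma abs_nnDiff_le {D : ℝ} (hD : ∀ x y, |truncDiff φ M r x y| ≤ D) (X : ℕ → E) (I : Finset ℕ)
    (x : E) : |nnDiff φ M r X I x| ≤ D := by
  unfold nnDiff
  split_ifs
  · exact hD _ _
  · simpa using (abs_nonneg _).trans (hD x x)

lemma nnDiff_eq_zero_of_forall_lt {X : ℕ → E} {I : Finset ℕ} {x : E}
    (h : ∀ k ∈ I, r < dist x (X k)) : nnDiff φ M r X I x = 0 := by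
  unfold nnDiff
  split_ifs with hI
  · exact truncDiff_of_lt (h _ (nnIndex_mem X hI x))
  · rfl

/-- Whatever the tie-break selects is at distance zero, hence equal to `x`. This handles repeated
sample points, which the deterministic bounds must allow. -/
lemma nnDiff_eq_zero_of_eq {X : ℕ → E} {I : Finset ℕ} {x : E} {k : ℕ} (hk : k ∈ I) (hx : x = X k) :
    nnDiff φ M r X I x = 0 := by
  unfold nnDiff
  rw [if_pos ⟨k, hk⟩]
  have h := dist_nnIndex_le X x hk
  rw [← hx, dist_self] at h
  rw [← dist_le_zero.1 h, truncDiff_self]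

lemma nnDiff_erase {X : ℕ → E} {I : Finset ℕ} (hI : I.Nonempty) {x : E} {j : ℕ}
    (hj : nnIndex X I x ≠ j) : nnDiff φ M r X (I.erase j) x = nnDiff φ M r X I x := by
  unfold nnDiff
  rw [if_pos hI, if_pos ⟨_, Finset.mem_erase.2 ⟨hj, nnIndex_mem X hI x⟩⟩, nnIndex_erase hI hj]

/-- Truncation localizes the influence of `X j`. Away from its ball, either `X j` is not the nearest
point and its deletion is not felt, or it is, and then all points are beyond `r` and both increments
vanish. -/
lemma abs_nnDiff_sub_erase_le {D : ℝ} (hD : ∀ x y, |truncDiff φ M r x y| ≤ D) (X : ℕ → E)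
    (I : Finset ℕ) (j : ℕ) (x : E) :
    |nnDiff φ M r X I x - nnDiff φ M r X (I.erase j) x|
      ≤ (Metric.closedBall (X j) r).indicator (fun _ => 2 * D) x := by
  have hD0 : 0 ≤ D := (abs_nonneg _).trans (hD x x)
  have hle := abs_sub (nnDiff φ M r X I x) (nnDiff φ M r X (I.erase j) x)
  have h1 := abs_nnDiff_le hD X I x
  have h2 := abs_nnDiff_le hD X (I.erase j) x
  rcases I.eq_empty_or_nonempty with rfl | hI
  · simp only [Finset.erase_empty, sub_self, abs_zero]
    exact Set.indicator_nonneg (fun _ _ => by positivity) _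
  by_cases hx : x ∈ Metric.closedBall (X j) r
  · rw [Set.indicator_of_mem hx]
    linarith
  · rw [Set.indicator_of_notMem hx]
    rw [Metric.mem_closedBall, not_le] at hx
    by_cases hj : nnIndex X I x = j
    · have hfar : ∀ k ∈ I, r < dist x (X k) := fun k hk => by
        have := dist_nnIndex_le X x hk
        rw [hj] at this
        linarith
      rw [nnDiff_eq_zero_of_forall_lt hfar,
        nnDiff_eq_zero_of_forall_lt fun k hk => hfar k (Finset.mem_of_mem_erase hk)]
      simp
    · rw [nnDiff_erase hI hj]; simp

variable [MeasurableSpace E] [BorelSpace E] [SecondCountableTopology E]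

lemma measurable_truncDiff (hM : MeasurableSet M) (hφ : Measurable (M.indicator φ)) :
    Measurable (Function.uncurry (truncDiff φ M r)) := by
  -- The cutoff discards the values of `φ` outside `M`, where nothing is known about `φ`.
  have : Function.uncurry (truncDiff φ M r)
      = (M ×ˢ M ∩ {p : E × E | dist p.1 p.2 ≤ r}).indicator
        (fun p => M.indicator φ p.2 - M.indicator φ p.1) := by
    ext ⟨x, y⟩
    by_cases h : x ∈ M ∧ y ∈ M ∧ dist x y ≤ r
    · have hm : (x, y) ∈ M ×ˢ M ∩ {p : E × E | dist p.1 p.2 ≤ r} := ⟨⟨h.1, h.2.1⟩, h.2.2⟩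
      rw [Set.indicator_of_mem hm]
      simp only [Function.uncurry, truncDiff, if_pos h, Set.indicator_of_mem h.1,
        Set.indicator_of_mem h.2.1]
    · have hm : (x, y) ∉ M ×ˢ M ∩ {p : E × E | dist p.1 p.2 ≤ r} :=
        fun hm => h ⟨hm.1.1, hm.1.2, hm.2⟩
      rw [Set.indicator_of_notMem hm]
      simp only [Function.uncurry, truncDiff, if_neg h]
  rw [this]
  exact ((hφ.comp measurable_snd).sub (hφ.comp measurable_fst)).indicator
    ((hM.prod hM).inter (measurableSet_le measurable_dist measurable_const))

lemma measurable_nnDiff (hM : MeasurableSet M) (hφ : Measurable (M.indicator φ))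
    {α : Type*} [MeasurableSpace α] {X : α → ℕ → E} (hX : ∀ k, Measurable fun a => X a k)
    {x : α → E} (hx : Measurable x) (I : Finset ℕ) :
    Measurable fun a => nnDiff φ M r (X a) I (x a) := by
  unfold nnDiff
  split_ifs
  · exact (measurable_truncDiff hM hφ).comp (f := fun a => (x a, X a (nnIndex (X a) I (x a))))
      (hx.prodMk (measurable_apply_nnIndex hX hx I))
  · exact measurable_const

end Truncated

/-! ### Effect of deleting one observation -/

section BoundedDifferences

variable {E : Type*} [NormedAddCommGroup E] {φ : E → ℝ} {M : Set E} {r : ℝ}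

/-- Only indices `i` whose leave-one-out neighbor is `j` feel the deletion of `j`. Packing allows at
most `κ` of them with `X i ≠ X j`, and coincidences with `X j` contribute at most one more. -/
lemma sum_abs_nnDiff_sub_erase_le {κ : ℕ}
    (hκ : ∀ (X : ℕ → E) (I : Finset ℕ) (j : ℕ) (S : Finset ℕ),
      (∀ i ∈ S, i ∈ I ∧ X i ≠ X j ∧ nnIndex X (I.erase i) (X i) = j) → S.card ≤ κ)
    {D : ℝ} (hD : ∀ x y, |truncDiff φ M r x y| ≤ D) (X : ℕ → E) {I : Finset ℕ} {j : ℕ}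
    (hj : j ∈ I) :
    ∑ i ∈ I.erase j, |nnDiff φ M r X (I.erase i) (X i)
        - nnDiff φ M r X ((I.erase i).erase j) (X i)| ≤ 2 * D * (κ + 1) := by
  classical
  have hD0 : 0 ≤ D := (abs_nonneg _).trans (hD 0 0)
  set T : ℕ → ℝ := fun i => |nnDiff φ M r X (I.erase i) (X i)
        - nnDiff φ M r X ((I.erase i).erase j) (X i)| with hT
  have hTle : ∀ i, T i ≤ 2 * D := fun i => by
    have h1 := abs_nnDiff_le hD X (I.erase i) (X i)
    have h2 := abs_nnDiff_le hD X ((I.erase i).erase j) (X i)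
    have := abs_sub (nnDiff φ M r X (I.erase i) (X i)) (nnDiff φ M r X ((I.erase i).erase j) (X i))
    simp only [hT]; linarith
  set A := (I.erase j).filter fun i => T i ≠ 0 with hA
  have hnn : ∀ i ∈ A, nnIndex X (I.erase i) (X i) = j := by
    intro i hi
    obtain ⟨hiI, hTi⟩ := Finset.mem_filter.1 hi
    by_contra hne
    refine hTi ?_
    have hmem : j ∈ I.erase i := Finset.mem_erase.2 ⟨(Finset.ne_of_mem_erase hiI).symm, hj⟩
    simp only [hT]
    rw [nnDiff_erase ⟨j, hmem⟩ hne, sub_self, abs_zero]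
  have hfar : (A.filter fun i => X i ≠ X j).card ≤ κ := by
    refine hκ X I j _ fun i hi => ?_
    obtain ⟨hiA, hne⟩ := Finset.mem_filter.1 hi
    exact ⟨Finset.mem_of_mem_erase (Finset.mem_filter.1 hiA).1, hne, hnn i hiA⟩
  -- If two indices `i`, `k` both sit at the location of `X j`, each keeps a neighbor at distance
  -- zero after the deletion, so neither contributes.
  have hnear : (A.filter fun i => ¬ X i ≠ X j).card ≤ 1 := by
    refine Finset.card_le_one.2 fun i hi k hk => ?_
    obtain ⟨hiA, hie⟩ := Finset.mem_filter.1 hi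
    obtain ⟨hkA, hke⟩ := Finset.mem_filter.1 hk
    obtain ⟨hiI, hTi⟩ := Finset.mem_filter.1 hiA
    obtain ⟨hkI, hTk⟩ := Finset.mem_filter.1 hkA
    rw [not_not] at hie hke
    by_contra hik
    refine hTi ?_
    have hki : k ≠ i := fun h => hik h.symm
    have hk1 : k ∈ I.erase i := Finset.mem_erase.2 ⟨hki, Finset.mem_of_mem_erase hkI⟩
    have hk2 : k ∈ (I.erase i).erase j := Finset.mem_erase.2 ⟨Finset.ne_of_mem_erase hkI, hk1⟩
    simp only [hT]
    rw [nnDiff_eq_zero_of_eq hk1 (hie.trans hke.symm), nnDiff_eq_zero_of_eq hk2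
      (hie.trans hke.symm), sub_self, abs_zero]
  have hcard : A.card ≤ κ + 1 := by
    rw [← Finset.card_filter_add_card_filter_not (s := A) (fun i => X i ≠ X j)]
    omega
  calc ∑ i ∈ I.erase j, T i = ∑ i ∈ A, T i := (Finset.sum_filter_ne_zero _).symm
    _ ≤ ∑ _i ∈ A, 2 * D := Finset.sum_le_sum fun i _ => hTle i
    _ = 2 * D * A.card := by rw [Finset.sum_const, nsmul_eq_mul, mul_comm]
    _ ≤ 2 * D * (κ + 1) := by
      gcongr
      exact_mod_cast hcard

variable [MeasurableSpace E]

/-- The truncated error with the observation `j` deleted. -/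
noncomputable def truncErrorErase (μ : Measure E) (φ : E → ℝ)
    (M : Set E) (r : ℝ) (n j : ℕ) (X : ℕ → E) : ℝ :=
  (1 / (n : ℝ)) * ∑ i ∈ (Finset.range n).erase j,
    ((∫ x, nnDiff φ M r X (((Finset.range n).erase i).erase j) x ∂μ)
      - nnDiff φ M r X (((Finset.range n).erase i).erase j) (X i))

/-- Deletion thus serves as the common intermediate between a sample and the same sample with
observation `j` replaced. -/
lemma truncErrorErase_congr (μ : Measure E) {n j : ℕ} {X Y : ℕ → E}
    (h : ∀ k, k ≠ j → X k = Y k) :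
    truncErrorErase μ φ M r n j X = truncErrorErase μ φ M r n j Y := by
  unfold truncErrorErase
  congr 1
  refine Finset.sum_congr rfl fun i hi => ?_
  have hc : ∀ x, nnDiff φ M r X (((Finset.range n).erase i).erase j) x
      = nnDiff φ M r Y (((Finset.range n).erase i).erase j) x :=
    nnDiff_congr fun k hk => h k (Finset.ne_of_mem_erase hk)
  simp only [hc, h i (Finset.ne_of_mem_erase hi)]

lemma abs_truncError_le {μ : Measure E} [IsProbabilityMeasure μ]
    {D : ℝ} (hD : ∀ x y, |truncDiff φ M r x y| ≤ D) {n : ℕ} (hn : 0 < n) (X : ℕ → E) :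
    |truncError μ φ M r n X| ≤ 2 * D := by
  unfold truncError
  have hn' : (0 : ℝ) < n := by exact_mod_cast hn
  rw [abs_mul, abs_of_pos (one_div_pos.2 hn')]
  calc _ ≤ 1 / (n : ℝ) * ∑ i ∈ Finset.range n, 2 * D := by
        gcongr
        refine (Finset.abs_sum_le_sum_abs _ _).trans (Finset.sum_le_sum fun i _ => ?_)
        have h1 := abs_integral_le_of_abs_le (ν := μ)
          fun x => abs_nnDiff_le hD X ((Finset.range n).erase i) x
        have h2 := abs_nnDiff_le hD X ((Finset.range n).erase i) (X i)
        exact (abs_sub _ _).trans (by linarith)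
    _ = 2 * D := by
        rw [Finset.sum_const, Finset.card_range, nsmul_eq_mul]; field_simp

variable [BorelSpace E] [SecondCountableTopology E]

/-- Three effects add up, all divided by `n`: the summand `j` is lost (`2D`), each integral changes
only on a ball about `X j` (`2Dm` for each of at most `n` indices), and the evaluations at sample
points change by `2D(κ + 1)` in total. -/
lemma abs_truncError_sub_erase_le {μ : Measure E} [IsProbabilityMeasure μ]
    (hM : MeasurableSet M) (hφ : Measurable (M.indicator φ)) {κ : ℕ}
    (hκ : ∀ (X : ℕ → E) (I : Finset ℕ) (j : ℕ) (S : Finset ℕ),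
      (∀ i ∈ S, i ∈ I ∧ X i ≠ X j ∧ nnIndex X (I.erase i) (X i) = j) → S.card ≤ κ)
    {D : ℝ} (hD : ∀ x y, |truncDiff φ M r x y| ≤ D) {m : ℝ}
    (hm : ∀ y, μ.real (Metric.closedBall y r) ≤ m) (X : ℕ → E) {n j : ℕ} (hj : j < n) :
    |truncError μ φ M r n X - truncErrorErase μ φ M r n j X|
      ≤ 2 * D / n * (κ + 2 + n * m) := by
  have hD0 : 0 ≤ D := (abs_nonneg _).trans (hD 0 0)
  have hm0 : 0 ≤ m := measureReal_nonneg.trans (hm 0)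
  have hn : (0 : ℝ) < n := by exact_mod_cast (Nat.zero_le j).trans_lt hj
  have hjr : j ∈ Finset.range n := Finset.mem_range.2 hj
  set I := Finset.range n with hI
  have hint : ∀ J, Integrable (fun x => nnDiff φ M r X J x) μ := fun J =>
    integrable_of_measurable_of_abs_le
      (measurable_nnDiff (X := fun _ => X) hM hφ (fun _ => measurable_const) measurable_id J)
      (fun x => abs_nnDiff_le hD X J x)
  have hint2 : ∀ i, |∫ x, nnDiff φ M r X (I.erase i) x ∂μ
      - ∫ x, nnDiff φ M r X ((I.erase i).erase j) x ∂μ| ≤ 2 * D * m := by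
    intro i
    rw [← integral_sub (hint _) (hint _)]
    calc |∫ x, (nnDiff φ M r X (I.erase i) x - nnDiff φ M r X ((I.erase i).erase j) x) ∂μ|
        ≤ ∫ x, |nnDiff φ M r X (I.erase i) x - nnDiff φ M r X ((I.erase i).erase j) x| ∂μ :=
          abs_integral_le_integral_abs
      _ ≤ ∫ x, (Metric.closedBall (X j) r).indicator (fun _ => 2 * D) x ∂μ := by
          refine integral_mono ((hint _).sub (hint _)).abs ?_ fun x =>
            abs_nnDiff_sub_erase_le hD X _ j x
          exact (integrable_const _).indicator Metric.isClosed_closedBall.measurableSet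
      _ = μ.real (Metric.closedBall (X j) r) * (2 * D) := by
          rw [integral_indicator_const _ Metric.isClosed_closedBall.measurableSet, smul_eq_mul]
      _ ≤ 2 * D * m := by
          rw [mul_comm]; gcongr; exact hm _
  unfold truncError truncErrorErase
  rw [← hI, ← Finset.add_sum_erase I _ hjr, ← mul_sub, add_sub_assoc, ← Finset.sum_sub_distrib,
    abs_mul, abs_of_pos (one_div_pos.2 hn)]
  have hfirst : |(∫ x, nnDiff φ M r X (I.erase j) x ∂μ) - nnDiff φ M r X (I.erase j) (X j)|
      ≤ 2 * D := by
    have h1 := abs_integral_le_of_abs_le (ν := μ) fun x => abs_nnDiff_le hD X (I.erase j) x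
    have h2 := abs_nnDiff_le hD X (I.erase j) (X j)
    exact (abs_sub _ _).trans (by linarith)
  have hrest : |∑ i ∈ I.erase j, ((∫ x, nnDiff φ M r X (I.erase i) x ∂μ)
        - nnDiff φ M r X (I.erase i) (X i)
        - ((∫ x, nnDiff φ M r X ((I.erase i).erase j) x ∂μ)
        - nnDiff φ M r X ((I.erase i).erase j) (X i)))| ≤ n * (2 * D * m) + 2 * D * (κ + 1) := by
    calc _ ≤ ∑ i ∈ I.erase j, |(∫ x, nnDiff φ M r X (I.erase i) x ∂μ)
        - nnDiff φ M r X (I.erase i) (X i)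
        - ((∫ x, nnDiff φ M r X ((I.erase i).erase j) x ∂μ)
        - nnDiff φ M r X ((I.erase i).erase j) (X i))| := Finset.abs_sum_le_sum_abs _ _
      _ ≤ ∑ i ∈ I.erase j, (2 * D * m + |nnDiff φ M r X (I.erase i) (X i)
          - nnDiff φ M r X ((I.erase i).erase j) (X i)|) := by
          refine Finset.sum_le_sum fun i _ => ?_
          rw [sub_sub_sub_comm]
          exact (abs_sub _ _).trans (by gcongr; exact hint2 i)
      _ ≤ n * (2 * D * m) + 2 * D * (κ + 1) := by
          rw [Finset.sum_add_distrib]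
          gcongr
          · rw [Finset.sum_const, nsmul_eq_mul]
            gcongr
            refine (Finset.card_erase_le).trans_eq ?_
            rw [hI, Finset.card_range]
          · exact sum_abs_nnDiff_sub_erase_le hκ hD X hjr
  calc _ ≤ 1 / (n : ℝ) * (2 * D + (n * (2 * D * m) + 2 * D * (κ + 1))) := by
        gcongr
        exact (abs_add_le _ _).trans (add_le_add hfirst hrest)
    _ = 2 * D / n * (κ + 2 + n * m) := by field_simp; ring

end BoundedDifferences

/-! ### Centering and concentration of the truncated error -/

section Sample

variable {E : Type*} [NormedAddCommGroup E]

/-- The sequence with the given first `n` terms, continued by zero. -/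
def extendZero {n : ℕ} (z : Fin n → E) (k : ℕ) : E := if h : k < n then z ⟨k, h⟩ else 0

lemma extendZero_val {n : ℕ} (z : Fin n → E) (i : Fin n) : extendZero z i = z i := by
  simp [extendZero]

lemma extendZero_update {n : ℕ} (z : Fin n → E) (j : Fin n) (y : E) {k : ℕ} (hk : k ≠ j) :
    extendZero (Function.update z j y) k = extendZero z k := by
  unfold extendZero
  split_ifs with h
  · rw [Function.update_of_ne]
    rintro rfl
    exact hk rfl
  · rfl

lemma measurable_extendZero [MeasurableSpace E] {n : ℕ} (k : ℕ) :
    Measurable fun z : Fin n → E => extendZero z k := by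
  unfold extendZero
  split_ifs
  · exact measurable_pi_apply _
  · exact measurable_const

variable {φ : E → ℝ} {M : Set E} {r : ℝ}
  [MeasurableSpace E] [BorelSpace E] [SecondCountableTopology E]

lemma measurable_nnDiff_extendZero (hM : MeasurableSet M) (hφ : Measurable (M.indicator φ))
    {n : ℕ} (I : Finset ℕ) :
    Measurable fun p : E × (Fin n → E) => nnDiff φ M r (extendZero p.2) I p.1 :=
  measurable_nnDiff (X := fun p : E × (Fin n → E) => extendZero p.2) hM hφ
    (fun k => (measurable_extendZero k).comp measurable_snd) measurable_fst I

lemma measurable_truncError {μ : Measure E} [SFinite μ] (hM : MeasurableSet M)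
    (hφ : Measurable (M.indicator φ)) {n : ℕ} :
    Measurable fun z : Fin n → E => truncError μ φ M r n (extendZero z) := by
  unfold truncError
  refine (Finset.measurable_sum _ fun i _ => ?_).const_mul _
  refine Measurable.sub ?_ ?_
  · exact (measurable_nnDiff_extendZero hM hφ _).stronglyMeasurable.integral_prod_left'.measurable
  · exact measurable_nnDiff hM hφ measurable_extendZero (measurable_extendZero i) _

/-- The leave-one-out increment does not involve `X i`, so evaluating it at `X i` has the same mean
as integrating it against `μ`. The cutoff depends only on the evaluation point and its neighbor and
does not disturb this. -/
lemma integral_truncError {μ : Measure E} [IsProbabilityMeasure μ] (hM : MeasurableSet M)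
    (hφ : Measurable (M.indicator φ)) {D : ℝ} (hD : ∀ x y, |truncDiff φ M r x y| ≤ D) {n : ℕ} :
    ∫ z : Fin n → E, truncError μ φ M r n (extendZero z) ∂(Measure.pi fun _ => μ) = 0 := by
  unfold truncError
  have hi1 : ∀ i, Integrable (fun z : Fin n → E =>
      ∫ x, nnDiff φ M r (extendZero z) ((Finset.range n).erase i) x ∂μ)
      (Measure.pi fun _ => μ) := fun i =>
    integrable_of_measurable_of_abs_le
      (measurable_nnDiff_extendZero hM hφ _).stronglyMeasurable.integral_prod_left'.measurable
      fun z => abs_integral_le_of_abs_le fun x => abs_nnDiff_le hD _ _ _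
  have hi2 : ∀ i, Integrable (fun z : Fin n → E =>
      nnDiff φ M r (extendZero z) ((Finset.range n).erase i) (extendZero z i))
      (Measure.pi fun _ => μ) := fun i =>
    integrable_of_measurable_of_abs_le
      (measurable_nnDiff hM hφ measurable_extendZero (measurable_extendZero i) _)
      fun z => abs_nnDiff_le hD _ _ _
  rw [integral_const_mul, integral_finsetSum]
  swap
  · exact fun i _ => (hi1 i).sub (hi2 i)
  refine mul_eq_zero_of_right _ (Finset.sum_eq_zero fun i hi => ?_)
  rw [integral_sub (hi1 i) (hi2 i), sub_eq_zero]
  have hi' : i < n := Finset.mem_range.1 hi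
  have h := integral_resample (ν := μ) (⟨i, hi'⟩ : Fin n)
    (H := fun x z => nnDiff φ M r (extendZero z) ((Finset.range n).erase i) x)
    (measurable_nnDiff_extendZero hM hφ _) (fun x z => abs_nnDiff_le hD _ _ _)
    (fun x z y => nnDiff_congr (fun k hk =>
      extendZero_update z ⟨i, hi'⟩ y (Finset.ne_of_mem_erase hk)) x)
  rw [← h]
  refine integral_congr_ae (Filter.Eventually.of_forall fun z => ?_)
  change nnDiff φ M r (extendZero z) _ (z ⟨i, hi'⟩) = _
  rw [← extendZero_val z ⟨i, hi'⟩]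

/-- Concentration of the truncated error. -/
lemma measure_abs_truncError_ge_le {μ : Measure E} [IsProbabilityMeasure μ]
    (hM : MeasurableSet M) (hφ : Measurable (M.indicator φ)) {κ : ℕ}
    (hκ : ∀ (X : ℕ → E) (I : Finset ℕ) (j : ℕ) (S : Finset ℕ),
      (∀ i ∈ S, i ∈ I ∧ X i ≠ X j ∧ nnIndex X (I.erase i) (X i) = j) → S.card ≤ κ)
    {D : ℝ} (hD : ∀ x y, |truncDiff φ M r x y| ≤ D) {m : ℝ}
    (hm : ∀ y, μ.real (Metric.closedBall y r) ≤ m) {n : ℕ} (hn : 0 < n) {a : ℝ} (ha : 0 ≤ a) :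
    (Measure.pi fun _ : Fin n => μ).real {z | a ≤ |truncError μ φ M r n (extendZero z)|}
      ≤ 2 * Real.exp (-a ^ 2 / (2 * (n * (4 * D / n * (κ + 2 + n * m)) ^ 2))) := by
  refine measure_abs_ge_le_of_bounded_differences (measurable_truncError hM hφ)
    (fun z => abs_truncError_le hD hn _) (fun z j y => ?_) (integral_truncError hM hφ hD) ha
  -- Passing through the deleted sample uses the deletion bound twice, which turns `2 * D` into `4 *
  -- D`.
  have h1 := abs_truncError_sub_erase_le (μ := μ) hM hφ hκ hD hm (extendZero z) j.2
  have h2 := abs_truncError_sub_erase_le (μ := μ) hM hφ hκ hD hm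
    (extendZero (Function.update z j y)) j.2
  rw [truncErrorErase_congr μ (Y := extendZero z) fun k hk => extendZero_update z j y hk] at h2
  rw [abs_sub_comm] at h1
  refine (abs_sub_le _ _ _).trans ((add_le_add h2 h1).trans (le_of_eq ?_))
  ring

end Sample

/-! ### From the truncated error to the estimates -/

lemma integrable_of_oscillation {E : Type*} [MeasurableSpace E] {μ : Measure E} [IsProbabilityMeasure μ] {M : Set E} {φ : E → ℝ}
    (hμM : μ Mᶜ = 0) (hφ : Measurable (M.indicator φ)) {C : ℝ}
    (hC : ∀ x ∈ M, ∀ y ∈ M, |φ x - φ y| ≤ C) {x₀ : E} (hx₀ : x₀ ∈ M) : Integrable φ μ := by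
  have hae : M.indicator φ =ᵐ[μ] φ := by
    filter_upwards [compl_mem_ae_iff.2 hμM] with x hx
    rw [compl_compl] at hx
    exact Set.indicator_of_mem hx φ
  refine Integrable.congr (integrable_of_measurable_of_abs_le (B := |φ x₀| + C) hφ fun x => ?_) hae
  by_cases hx : x ∈ M
  · rw [Set.indicator_of_mem hx]
    have := hC x hx x₀ hx₀
    have := abs_sub_abs_le_abs_sub (φ x) (φ x₀)
    linarith
  · rw [Set.indicator_of_notMem hx, abs_zero]
    have := (abs_nonneg _).trans (hC x₀ hx₀ x₀ hx₀)
    positivity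

lemma abs_sum_div_le {n : ℕ} (hn : 0 < n) {u : ℕ → ℝ} {B : ℝ} (hu : ∀ i < n, |u i| ≤ B) :
    |(1 / (n : ℝ)) * ∑ i ∈ Finset.range n, u i| ≤ B := by
  have hn' : (0 : ℝ) < n := by exact_mod_cast hn
  rw [abs_mul, abs_of_pos (one_div_pos.2 hn')]
  calc _ ≤ 1 / (n : ℝ) * ∑ i ∈ Finset.range n, B := by
        gcongr
        exact (Finset.abs_sum_le_sum_abs _ _).trans
          (Finset.sum_le_sum fun i hi => hu i (Finset.mem_range.1 hi))
    _ = B := by rw [Finset.sum_const, Finset.card_range, nsmul_eq_mul]; field_simp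

lemma abs_integral_le_of_ae_abs_le_indicator {E : Type*}
    [MeasurableSpace E] {μ : Measure E} [IsProbabilityMeasure μ] {g : E → ℝ} {S : Set E} (hS : MeasurableSet S)
    {A C η : ℝ} (hC : 0 ≤ C) (hη : μ.real S ≤ η) (hg : Integrable g μ)
    (h : ∀ᵐ x ∂μ, |g x| ≤ A + S.indicator (fun _ => C) x) : |∫ x, g x ∂μ| ≤ A + C * η := by
  calc |∫ x, g x ∂μ| ≤ ∫ x, |g x| ∂μ := abs_integral_le_integral_abs
    _ ≤ ∫ x, (A + S.indicator (fun _ => C) x) ∂μ := by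
        refine integral_mono_ae hg.abs ?_ h
        exact (integrable_const A).add ((integrable_const C).indicator hS)
    _ = A + μ.real S * C := by
        rw [integral_add (integrable_const A) ((integrable_const C).indicator hS),
          integral_indicator_const _ hS]
        simp
    _ ≤ A + C * η := by rw [mul_comm C]; gcongr

section Deterministic

variable {E : Type*} [MetricSpace E]

lemma range_erase_nonempty {n : ℕ} (hn : 2 ≤ n) (i : ℕ) : ((Finset.range n).erase i).Nonempty := by
  rw [← Finset.card_pos]
  have := Finset.pred_card_le_card_erase (s := Finset.range n) (a := i)
  rw [Finset.card_range] at this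
  omega

lemma nearest_congr {X Y : ℕ → E} {n : ℕ} (hn : 2 ≤ n) (h : ∀ k < n, X k = Y k) (x : E) :
    nearest X n x = nearest Y n x := by
  have h' : ∀ k ∈ Finset.range n, X k = Y k := fun k hk => h k (Finset.mem_range.1 hk)
  unfold nearest
  rw [nnIndex_congr h', h' _ (nnIndex_mem Y ⟨0, Finset.mem_range.2 (by omega)⟩ x)]

lemma nearestLoo_congr {X Y : ℕ → E} {n : ℕ} (hn : 2 ≤ n) (h : ∀ k < n, X k = Y k) (i : ℕ)
    (x : E) : nearestLoo X n i x = nearestLoo Y n i x := by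
  have h' : ∀ k ∈ (Finset.range n).erase i, X k = Y k :=
    fun k hk => h k (Finset.mem_range.1 (Finset.mem_of_mem_erase hk))
  unfold nearestLoo
  rw [nnIndex_congr h', h' _ (nnIndex_mem Y (range_erase_nonempty hn i) x)]

lemma nearest_mem {X : ℕ → E} {n : ℕ} (hn : 2 ≤ n) {M : Set E} (h : ∀ k < n, X k ∈ M) (x : E) :
    nearest X n x ∈ M :=
  h _ (Finset.mem_range.1 (nnIndex_mem X ⟨0, Finset.mem_range.2 (by omega)⟩ x))

lemma nearestLoo_mem {X : ℕ → E} {n : ℕ} (hn : 2 ≤ n) {M : Set E} (h : ∀ k < n, X k ∈ M) (i : ℕ)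
    (x : E) : nearestLoo X n i x ∈ M :=
  h _ (Finset.mem_range.1 (Finset.mem_of_mem_erase
    (nnIndex_mem X (range_erase_nonempty hn i) x)))

/-- All sample points `X k`, `k < n`, `k ≠ i`, are at distance more than `r` from `x`. -/
def IsFar (r : ℝ) (n : ℕ) (X : ℕ → E) (i : ℕ) (x : E) : Prop :=
  ∀ k ∈ (Finset.range n).erase i, r < dist x (X k)

/-- The points that are far from all but at most one of the sample points. -/
def farSet (r : ℝ) (n : ℕ) (X : ℕ → E) : Set E := {x | ∃ i < n, IsFar r n X i x}

lemma nnDiff_eq_of_not_isFar {M : Set E} {φ : E → ℝ} {r : ℝ} {n : ℕ}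
    {X : ℕ → E} (hn : 2 ≤ n) (hX : ∀ k < n, X k ∈ M) {i : ℕ} {x : E} (hx : x ∈ M)
    (hfar : ¬ IsFar r n X i x) :
    nnDiff φ M r X ((Finset.range n).erase i) x = φ (nearestLoo X n i x) - φ x := by
  simp only [IsFar, not_forall, not_lt] at hfar
  obtain ⟨k, hk, hle⟩ := hfar
  unfold nnDiff truncDiff
  rw [if_pos (range_erase_nonempty hn i), if_pos]
  · rfl
  · exact ⟨hx, nearestLoo_mem hn hX i x, (dist_nnIndex_le X x hk).trans hle⟩

variable [MeasurableSpace E]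

lemma estimateLoo_congr (μ : Measure E) (φ : E → ℝ) {X Y : ℕ → E} {n : ℕ} (hn : 2 ≤ n)
    (h : ∀ k < n, X k = Y k) : estimateLoo μ φ X n = estimateLoo μ φ Y n := by
  unfold estimateLoo
  congr 1
  refine Finset.sum_congr rfl fun i hi => ?_
  simp only [h i (Finset.mem_range.1 hi), nearestLoo_congr hn h]

lemma estimateNN_congr (μ : Measure E) (φ : E → ℝ) {X Y : ℕ → E} {n : ℕ} (hn : 2 ≤ n)
    (h : ∀ k < n, X k = Y k) : estimateNN μ φ X n = estimateNN μ φ Y n := by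
  unfold estimateNN
  congr 1
  refine Finset.sum_congr rfl fun i hi => ?_
  simp only [h i (Finset.mem_range.1 hi), nearestLoo_congr hn h, nearest_congr hn h]

variable [BorelSpace E] [SecondCountableTopology E]

lemma measurableSet_isFar {α : Type*} [MeasurableSpace α] {X : α → ℕ → E}
    (hX : ∀ k, Measurable fun a => X a k) {x : α → E} (hx : Measurable x) (r : ℝ) (n i : ℕ) :
    MeasurableSet {a | IsFar r n (X a) i (x a)} := by
  have : {a | IsFar r n (X a) i (x a)}
      = ⋂ k ∈ (Finset.range n).erase i, {a | r < dist (x a) (X a k)} := by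
    ext a; simp [IsFar]
  rw [this]
  exact Finset.measurableSet_biInter _ fun k _ =>
    measurableSet_lt measurable_const (hx.dist (hX k))

variable {μ : Measure E} [IsProbabilityMeasure μ] {M : Set E} {φ : E → ℝ} {r : ℝ} {n : ℕ}
  {X : ℕ → E}

lemma measurableSet_farSet : MeasurableSet (farSet r n X) := by
  have : farSet r n X = ⋃ i ∈ Finset.range n, {x | IsFar r n X i x} := by
    ext x; simp [farSet]
  rw [this]
  exact Finset.measurableSet_biUnion _ fun i _ =>
    measurableSet_isFar (X := fun _ : E => X) (fun _ => measurable_const) measurable_id r n i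

lemma integrable_apply_nearestLoo (hn : 2 ≤ n) {C : ℝ} (hC : ∀ x ∈ M, ∀ y ∈ M, |φ x - φ y| ≤ C)
    (hX : ∀ k < n, X k ∈ M) (i : ℕ) : Integrable (fun x => φ (nearestLoo X n i x)) μ := by
  -- For a fixed sample the composition factors through the index, which takes countably many
  -- values; no measurability of `φ` is needed.
  have hm : Measurable fun x => φ (nearestLoo X n i x) :=
    (measurable_of_countable fun k => φ (X k)).comp
      (measurable_nnIndex (X := fun _ : E => X) (fun _ => measurable_const) measurable_id _)
  refine integrable_of_measurable_of_abs_le (B := |φ (X 0)| + C) hm fun x => ?_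
  have := hC _ (nearestLoo_mem hn hX i x) _ (hX 0 (by omega))
  have := abs_sub_abs_le_abs_sub (φ (nearestLoo X n i x)) (φ (X 0))
  linarith

lemma integrable_apply_nearest (hn : 2 ≤ n) {C : ℝ} (hC : ∀ x ∈ M, ∀ y ∈ M, |φ x - φ y| ≤ C)
    (hX : ∀ k < n, X k ∈ M) : Integrable (fun x => φ (nearest X n x)) μ := by
  have hm : Measurable fun x => φ (nearest X n x) :=
    (measurable_of_countable fun k => φ (X k)).comp
      (measurable_nnIndex (X := fun _ : E => X) (fun _ => measurable_const) measurable_id _)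
  refine integrable_of_measurable_of_abs_le (B := |φ (X 0)| + C) hm fun x => ?_
  have := hC _ (nearest_mem hn hX x) _ (hX 0 (by omega))
  have := abs_sub_abs_le_abs_sub (φ (nearest X n x)) (φ (X 0))
  linarith

/-- With no isolated sample point, the cutoff is inactive at every `X i` and the evaluations cancel
exactly. Only the integrals differ, and only over `farSet`, by at most the oscillation of `φ`. -/
lemma abs_estimateLoo_sub_integral_sub_truncError_le (hn : 2 ≤ n) (hμM : μ Mᶜ = 0)
    (hM : MeasurableSet M) (hφ : Measurable (M.indicator φ)) {C : ℝ}
    (hC : ∀ x ∈ M, ∀ y ∈ M, |φ x - φ y| ≤ C) {D : ℝ} (hD : ∀ x y, |truncDiff φ M r x y| ≤ D)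
    (hX : ∀ k < n, X k ∈ M) (hnear : ∀ i < n, ¬ IsFar r n X i (X i)) {η : ℝ}
    (hfar : μ.real (farSet r n X) ≤ η) :
    |estimateLoo μ φ X n - ∫ x, φ x ∂μ - truncError μ φ M r n X| ≤ C * η := by
  have hC0 : 0 ≤ C := (abs_nonneg _).trans (hC _ (hX 0 (by omega)) _ (hX 0 (by omega)))
  have hn0 : (n : ℝ) ≠ 0 := by positivity
  have hφi := integrable_of_oscillation hμM hφ hC (hX 0 (by omega))
  have hNi := fun i => integrable_apply_nearestLoo (μ := μ) hn hC hX i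
  have hdi : ∀ i, Integrable (fun x => nnDiff φ M r X ((Finset.range n).erase i) x) μ := fun J =>
    integrable_of_measurable_of_abs_le
      (measurable_nnDiff (X := fun _ => X) hM hφ (fun _ => measurable_const) measurable_id _)
      (fun x => abs_nnDiff_le hD X _ x)
  have hmean : ∫ x, φ x ∂μ = (1 / (n : ℝ)) * ∑ i ∈ Finset.range n, ∫ x, φ x ∂μ := by
    rw [Finset.sum_const, Finset.card_range, nsmul_eq_mul]; field_simp
  have key : estimateLoo μ φ X n - ∫ x, φ x ∂μ - truncError μ φ M r n X
      = (1 / (n : ℝ)) * ∑ i ∈ Finset.range n, ∫ x, (φ (nearestLoo X n i x) - φ x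
        - nnDiff φ M r X ((Finset.range n).erase i) x) ∂μ := by
    rw [hmean]
    unfold estimateLoo truncError
    rw [← mul_sub, ← mul_sub, ← Finset.sum_sub_distrib, ← Finset.sum_sub_distrib]
    congr 1
    refine Finset.sum_congr rfl fun i hi => ?_
    have hi' := Finset.mem_range.1 hi
    rw [nnDiff_eq_of_not_isFar hn hX (hX i hi') (hnear i hi'), integral_sub _ (hdi i),
      integral_sub (hNi i) hφi]
    · ring
    · exact (hNi i).sub hφi
  rw [key]
  refine abs_sum_div_le (by omega) fun i hi => ?_
  have hg : Integrable (fun x => φ (nearestLoo X n i x) - φ x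
        - nnDiff φ M r X ((Finset.range n).erase i) x) μ := ((hNi i).sub hφi).sub (hdi i)
  refine (abs_integral_le_of_ae_abs_le_indicator (A := 0) measurableSet_farSet hC0 hfar hg ?_).trans
    (by rw [zero_add])
  filter_upwards [compl_mem_ae_iff.2 hμM] with x hx
  rw [compl_compl] at hx
  rw [zero_add]
  by_cases hf : IsFar r n X i x
  · have hmem : x ∈ farSet r n X := ⟨i, hi, hf⟩
    rw [Set.indicator_of_mem hmem]
    have : nnDiff φ M r X ((Finset.range n).erase i) x = 0 := nnDiff_eq_zero_of_forall_lt hf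
    rw [this, sub_zero]
    exact hC _ (nearestLoo_mem hn hX i x) _ hx
  · rw [nnDiff_eq_of_not_isFar hn hX hx hf, sub_self, abs_zero]
    exact Set.indicator_nonneg (fun _ _ => hC0) x

/-- At a given `x`, removing `i` matters only if `i` is the nearest index. With the sum inside the
integral a single term survives, so the prefactor `1/n` is not compensated by `n` summands. Off
`farSet` both neighbors are within `r`, whence `2D`. -/
lemma abs_estimateNN_sub_estimateLoo_le (hn : 2 ≤ n) (hμM : μ Mᶜ = 0)
    {C : ℝ} (hC : ∀ x ∈ M, ∀ y ∈ M, |φ x - φ y| ≤ C) {D : ℝ}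
    (hD : ∀ x y, |truncDiff φ M r x y| ≤ D)
    (hX : ∀ k < n, X k ∈ M) {η : ℝ} (hfar : μ.real (farSet r n X) ≤ η) :
    |estimateNN μ φ X n - estimateLoo μ φ X n| ≤ 1 / (n : ℝ) * (2 * D + C * η) := by
  have hC0 : 0 ≤ C := (abs_nonneg _).trans (hC _ (hX 0 (by omega)) _ (hX 0 (by omega)))
  have hD0 : 0 ≤ D := (abs_nonneg _).trans (hD (X 0) (X 0))
  have hNi := fun i => integrable_apply_nearestLoo (μ := μ) hn hC hX i
  have hN := integrable_apply_nearest (μ := μ) hn hC hX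
  have hr : (Finset.range n).Nonempty := ⟨0, Finset.mem_range.2 (by omega)⟩
  have key : estimateNN μ φ X n - estimateLoo μ φ X n
      = (1 / (n : ℝ)) * ∫ x, ∑ i ∈ Finset.range n, (φ (nearest X n x) - φ (nearestLoo X n i x))
        ∂μ := by
    rw [integral_finsetSum]
    swap
    · exact fun i _ => hN.sub (hNi i)
    unfold estimateLoo estimateNN
    rw [← mul_sub, ← Finset.sum_sub_distrib]
    congr 1
    refine Finset.sum_congr rfl fun i _ => ?_
    rw [integral_sub hN (hNi i)]
    ring
  rw [key, abs_mul, abs_of_nonneg (by positivity)]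
  gcongr
  refine abs_integral_le_of_ae_abs_le_indicator measurableSet_farSet hC0 hfar
    (integrable_finsetSum _ fun i _ => hN.sub (hNi i)) ?_
  filter_upwards [compl_mem_ae_iff.2 hμM] with x hx
  rw [compl_compl] at hx
  have hi₀ := nnIndex_mem X hr x
  set i₀ := nnIndex X (Finset.range n) x with hi₀'
  rw [Finset.sum_eq_single_of_mem i₀ hi₀]
  · by_cases hf : x ∈ farSet r n X
    · rw [Set.indicator_of_mem hf]
      have := hC _ (nearest_mem hn hX x) _ (nearestLoo_mem hn hX i₀ x)
      linarith
    · rw [Set.indicator_of_notMem hf, add_zero]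
      have hnf : ¬ IsFar r n X i₀ x := fun h => hf ⟨i₀, Finset.mem_range.1 hi₀, h⟩
      simp only [IsFar, not_forall, not_lt] at hnf
      obtain ⟨k, hk, hle⟩ := hnf
      have h1 : |φ (nearest X n x) - φ x| ≤ D := by
        have h := hD x (nearest X n x)
        rwa [truncDiff, if_pos] at h
        exact ⟨hx, nearest_mem hn hX x,
          (dist_nnIndex_le X x (Finset.mem_of_mem_erase hk)).trans hle⟩
      have h2 : |φ (nearestLoo X n i₀ x) - φ x| ≤ D := by
        have h := hD x (nearestLoo X n i₀ x)
        rwa [truncDiff, if_pos] at h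
        exact ⟨hx, nearestLoo_mem hn hX i₀ x, (dist_nnIndex_le X x hk).trans hle⟩
      have := abs_sub_le (φ (nearest X n x)) (φ x) (φ (nearestLoo X n i₀ x))
      rw [abs_sub_comm (φ x)] at this
      linarith
  · intro i _ hne
    unfold nearest nearestLoo
    rw [nnIndex_erase hr (j := i) (fun h => hne (hi₀'.trans h).symm), sub_self]

/-- A bound without probability, for samples so small that `r` would exceed `r₀`. -/
lemma abs_estimate_sub_integral_le (hn : 2 ≤ n) (hμM : μ Mᶜ = 0)
    (hφ : Measurable (M.indicator φ)) {C : ℝ} (hC : ∀ x ∈ M, ∀ y ∈ M, |φ x - φ y| ≤ C)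
    (hX : ∀ k < n, X k ∈ M) :
    |estimateLoo μ φ X n - ∫ x, φ x ∂μ| ≤ 2 * C ∧
      |estimateNN μ φ X n - ∫ x, φ x ∂μ| ≤ 2 * C := by
  have hn0 : (n : ℝ) ≠ 0 := by positivity
  have hφi := integrable_of_oscillation hμM hφ hC (hX 0 (by omega))
  have hmean : ∫ x, φ x ∂μ = (1 / (n : ℝ)) * ∑ i ∈ Finset.range n, ∫ x, φ x ∂μ := by
    rw [Finset.sum_const, Finset.card_range, nsmul_eq_mul]; field_simp
  have hterm : ∀ g : E → E, (∀ x, g x ∈ M) → Integrable (fun x => φ (g x)) μ → ∀ i < n,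
      |φ (X i) - (φ (nearestLoo X n i (X i)) - ∫ x, φ (g x) ∂μ) - ∫ x, φ x ∂μ| ≤ 2 * C := by
    intro g hg hgi i hi
    have h1 := hC _ (hX i hi) _ (nearestLoo_mem hn hX i (X i))
    have h2 : |∫ x, φ (g x) ∂μ - ∫ x, φ x ∂μ| ≤ C := by
      rw [← integral_sub hgi hφi]
      have := norm_integral_le_of_norm_le_const (μ := μ) (f := fun x => φ (g x) - φ x) (C := C) (by
        filter_upwards [compl_mem_ae_iff.2 hμM] with x hx
        rw [compl_compl] at hx
        exact hC _ (hg x) _ hx)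
      simpa using this
    have h3 := abs_add_le (φ (X i) - φ (nearestLoo X n i (X i))) (∫ x, φ (g x) ∂μ - ∫ x, φ x ∂μ)
    have e : φ (X i) - (φ (nearestLoo X n i (X i)) - ∫ x, φ (g x) ∂μ) - ∫ x, φ x ∂μ
      = (φ (X i) - φ (nearestLoo X n i (X i))) + (∫ x, φ (g x) ∂μ - ∫ x, φ x ∂μ) := by ring
    rw [e]
    linarith
  constructor
  · rw [hmean]
    unfold estimateLoo
    rw [← mul_sub, ← Finset.sum_sub_distrib]
    exact abs_sum_div_le (by omega) fun i hi =>
      hterm _ (nearestLoo_mem hn hX i) (integrable_apply_nearestLoo hn hC hX i) i hi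
  · rw [hmean]
    unfold estimateNN
    rw [← mul_sub, ← Finset.sum_sub_distrib]
    exact abs_sum_div_le (by omega) fun i hi =>
      hterm _ (nearest_mem hn hX) (integrable_apply_nearest hn hC hX) i hi

end Deterministic

/-! ### Probability of remote nearest neighbors -/

section FarProbability

variable {E : Type*} [NormedAddCommGroup E] [MeasurableSpace E] [BorelSpace E]
  {μ : Measure E} [IsProbabilityMeasure μ] {r : ℝ} {n : ℕ}

/-- The `n - 1` points other than `i` miss the ball independently, each with probability at most `1
- p ≤ exp (-p)`. -/
lemma measure_isFar_le {x : E} {p : ℝ} (hp : p ≤ μ.real (Metric.closedBall x r)) (i : Fin n) :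
    (Measure.pi fun _ : Fin n => μ) {z | IsFar r n (extendZero z) i x}
      ≤ ENNReal.ofReal (Real.exp (-((n - 1 : ℝ) * p))) := by
  have hset : {z : Fin n → E | IsFar r n (extendZero z) i x}
      = Set.univ.pi (fun k => if k = i then Set.univ else (Metric.closedBall x r)ᶜ) := by
    ext z
    simp only [Set.mem_ofPred_eq, IsFar, Finset.mem_erase, Finset.mem_range, Set.mem_pi,
      Set.mem_univ, true_implies]
    constructor
    · intro h k
      split_ifs with hk
      · trivial
      · have := h k ⟨fun hki => hk (Fin.ext hki), k.2⟩
        rw [extendZero_val] at this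
        simpa [dist_comm] using this
    · rintro h k ⟨hki, hkn⟩
      have := h ⟨k, hkn⟩
      rw [if_neg (fun h => hki (by rw [← h]))] at this
      rw [← extendZero_val z ⟨k, hkn⟩] at this
      simpa [dist_comm] using this
  have hball : μ (Metric.closedBall x r)ᶜ ≤ ENNReal.ofReal (Real.exp (-p)) := by
    rw [← ofReal_measureReal]
    refine ENNReal.ofReal_le_ofReal ?_
    rw [probReal_compl_eq_one_sub Metric.isClosed_closedBall.measurableSet]
    have := Real.add_one_le_exp (-p)
    linarith
  have hn : 1 ≤ n := (Nat.zero_le _).trans_lt i.2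
  rw [hset, Measure.pi_pi, ← Finset.mul_prod_erase Finset.univ _ (Finset.mem_univ i), if_pos rfl,
    measure_univ, one_mul]
  calc _ ≤ ∏ k ∈ Finset.univ.erase i, ENNReal.ofReal (Real.exp (-p)) := by
        refine Finset.prod_le_prod' fun k hk => ?_
        rw [if_neg (Finset.ne_of_mem_erase hk)]
        exact hball
    _ = _ := by
        rw [Finset.prod_const, Finset.card_erase_of_mem (Finset.mem_univ i), Finset.card_univ,
          Fintype.card_fin, ← ENNReal.ofReal_pow (Real.exp_pos _).le, ← Real.exp_nat_mul,
          Nat.cast_sub hn]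
        congr 2
        push_cast
        ring

variable [SecondCountableTopology E] {M : Set E}

lemma prod_measure_isFar_le (hμM : μ Mᶜ = 0) {p : ℝ}
    (hp : ∀ x ∈ M, p ≤ μ.real (Metric.closedBall x r)) (i : Fin n) :
    (μ.prod (Measure.pi fun _ : Fin n => μ)) {q | IsFar r n (extendZero q.2) i q.1}
      ≤ ENNReal.ofReal (Real.exp (-((n - 1 : ℝ) * p))) := by
  have hS : MeasurableSet {q : E × (Fin n → E) | IsFar r n (extendZero q.2) i q.1} :=
    measurableSet_isFar (X := fun q : E × (Fin n → E) => extendZero q.2)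
      (fun k => (measurable_extendZero k).comp measurable_snd) measurable_fst r n i
  rw [Measure.prod_apply hS]
  calc _ ≤ ∫⁻ _x, ENNReal.ofReal (Real.exp (-((n - 1 : ℝ) * p))) ∂μ := by
        refine lintegral_mono_ae ?_
        filter_upwards [compl_mem_ae_iff.2 hμM] with x hx
        rw [compl_compl] at hx
        exact measure_isFar_le (hp x hx) i
    _ = _ := by simp

/-- Some sample point is far from all the others with small probability. -/
lemma measure_exists_isFar_le (hμM : μ Mᶜ = 0) {p : ℝ}
    (hp : ∀ x ∈ M, p ≤ μ.real (Metric.closedBall x r)) :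
    (Measure.pi fun _ : Fin n => μ) {z | ∃ i < n, IsFar r n (extendZero z) i (extendZero z i)}
      ≤ n * ENNReal.ofReal (Real.exp (-((n - 1 : ℝ) * p))) := by
  have hset : {z : Fin n → E | ∃ i < n, IsFar r n (extendZero z) i (extendZero z i)}
      ⊆ ⋃ i : Fin n, {z | IsFar r n (extendZero z) i (extendZero z i)} := by
    rintro z ⟨i, hi, h⟩
    exact Set.mem_iUnion.2 ⟨⟨i, hi⟩, h⟩
  refine (measure_mono hset).trans ((measure_iUnion_fintype_le _ _).trans ?_)
  calc _ ≤ ∑ _i : Fin n, ENNReal.ofReal (Real.exp (-((n - 1 : ℝ) * p))) := by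
        refine Finset.sum_le_sum fun i _ => ?_
        have hA : MeasurableSet {z : Fin n → E | IsFar r n (extendZero z) i (extendZero z i)} :=
          measurableSet_isFar measurable_extendZero (measurable_extendZero i) r n i
        -- Observation `i` is replaced by an independent point, so that the center is independent of
        -- the other points.
        rw [← (measurePreserving_update μ i).measure_preimage hA.nullMeasurableSet]
        refine (measure_mono ?_).trans (prod_measure_isFar_le hμM hp i)
        rintro ⟨x, z⟩ h k hk
        have h' := h k hk
        simp only at h'
        rwa [extendZero_val, Function.update_self,
          extendZero_update z i x (Finset.ne_of_mem_erase hk)] at h'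
    _ = _ := by simp

/-- The set of points with a remote nearest neighbor has small measure with high probability. -/
lemma measure_le_farSet_le (hμM : μ Mᶜ = 0) {p : ℝ}
    (hp : ∀ x ∈ M, p ≤ μ.real (Metric.closedBall x r)) {η : ℝ} (hη : 0 < η) :
    (Measure.pi fun _ : Fin n => μ) {z | ENNReal.ofReal η ≤ μ (farSet r n (extendZero z))}
      ≤ n * ENNReal.ofReal (Real.exp (-((n - 1 : ℝ) * p))) / ENNReal.ofReal η := by
  have hS : ∀ i : Fin n,
      MeasurableSet {q : E × (Fin n → E) | IsFar r n (extendZero q.2) i q.1} := fun i =>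
    measurableSet_isFar (X := fun q : E × (Fin n → E) => extendZero q.2)
      (fun k => (measurable_extendZero k).comp measurable_snd) measurable_fst r n i
  set S : Set (E × (Fin n → E)) := ⋃ i : Fin n, {q | IsFar r n (extendZero q.2) i q.1} with hSdef
  have hSm : MeasurableSet S := MeasurableSet.iUnion hS
  have hfar : ∀ z : Fin n → E, farSet r n (extendZero z) = (fun x => (x, z)) ⁻¹' S := by
    intro z
    ext x
    simp only [hSdef, farSet, Set.mem_ofPred_eq, Set.mem_preimage, Set.mem_iUnion]
    exact ⟨fun ⟨i, hi, h⟩ => ⟨⟨i, hi⟩, h⟩, fun ⟨i, h⟩ => ⟨i, i.2, h⟩⟩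
  simp only [hfar]
  have hm : Measurable fun z : Fin n → E => μ ((fun x => (x, z)) ⁻¹' S) :=
    measurable_measure_prodMk_right hSm
  -- Markov's inequality; by Fubini the mean of the mass of `farSet` is the product measure of `S`.
  refine (meas_ge_le_lintegral_div hm.aemeasurable (by simpa using hη)
    ENNReal.ofReal_ne_top).trans ?_
  gcongr
  rw [← Measure.prod_apply_symm hSm]
  refine (measure_iUnion_fintype_le _ _).trans ?_
  calc _ ≤ ∑ _i : Fin n, ENNReal.ofReal (Real.exp (-((n - 1 : ℝ) * p))) :=
        Finset.sum_le_sum fun i _ => prod_measure_isFar_le hμM hp i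
    _ = _ := by simp

end FarProbability

/-! ### Transfer to the product space, and the combined bound -/

/-- A property of the first `n` terms of an i.i.d. sequence can be checked on the product space. -/
lemma ofReal_one_sub_le_measure {E : Type*} [MeasurableSpace E] {μ : Measure E} {Ω : Type*}
    [MeasurableSpace Ω] {P : Measure Ω}
    [IsProbabilityMeasure P] {X : ℕ → Ω → E} (hX : ∀ i, Measurable (X i)) (hind : iIndepFun X P)
    (hlaw : ∀ i, P.map (X i) = μ) {n : ℕ} {Q : (Fin n → E) → Prop} {ε : ℝ} (hε : 0 ≤ ε)
    (hQ : (Measure.pi fun _ : Fin n => μ) {z | ¬ Q z} ≤ ENNReal.ofReal ε) {S : Set Ω}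
    (hS : ∀ ω, Q (fun i => X i ω) → ω ∈ S) : ENNReal.ofReal (1 - ε) ≤ P S := by
  have hmap : P.map (fun ω (i : Fin n) => X i ω) = Measure.pi fun _ => μ := by
    have h := hind.precomp (g := fun i : Fin n => (i : ℕ)) Fin.val_injective
    rw [iIndepFun_iff_map_fun_eq_pi_map fun i => (hX _).aemeasurable] at h
    rw [h]
    simp only [hlaw]
  have hm : Measurable fun ω (i : Fin n) => X i ω := measurable_pi_iff.2 fun i => hX i
  rw [ENNReal.ofReal_sub _ hε, ENNReal.ofReal_one, tsub_le_iff_right]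
  calc (1 : ENNReal) = P Set.univ := measure_univ.symm
    _ ≤ P (S ∪ (fun ω (i : Fin n) => X i ω) ⁻¹' {z | ¬ Q z}) := by
        refine measure_mono fun ω _ => ?_
        by_cases h : Q fun i => X i ω
        · exact Or.inl (hS ω h)
        · exact Or.inr h
    _ ≤ P S + P ((fun ω (i : Fin n) => X i ω) ⁻¹' {z | ¬ Q z}) := measure_union_le _ _
    _ ≤ P S + ENNReal.ofReal ε := by
        gcongr
        -- This inequality holds for arbitrary sets, so the failure event need not be measurable.
        refine (Measure.le_map_apply hm.aemeasurable _).trans ?_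
        rw [hmap]
        exact hQ

lemma ae_extendZero_mem {E : Type*} [NormedAddCommGroup E] [MeasurableSpace E] {μ : Measure E}
    [IsProbabilityMeasure μ] {M : Set E} (hμM : μ Mᶜ = 0) {n : ℕ} :
    ∀ᵐ z ∂(Measure.pi fun _ : Fin n => μ), ∀ k < n, extendZero z k ∈ M := by
  have h : ∀ i : Fin n, ∀ᵐ z ∂(Measure.pi fun _ : Fin n => μ), z i ∈ M := fun i => by
    have := (measurePreserving_eval (fun _ : Fin n => μ) i).quasiMeasurePreserving.ae
      (p := fun x => x ∈ M) (mem_ae_iff.2 hμM)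
    exact this
  filter_upwards [ae_all_iff.2 h] with z hz k hk
  have := hz ⟨k, hk⟩
  rwa [← extendZero_val z ⟨k, hk⟩] at this

section Concentration

variable {E : Type*} [NormedAddCommGroup E] [MeasurableSpace E] [BorelSpace E]
  [SecondCountableTopology E] {μ : Measure E} [IsProbabilityMeasure μ] {M : Set E}

/-- Concentration of both estimates, with the probability of failure left explicit. -/
lemma measure_not_estimate_le {φ : E → ℝ} {r : ℝ} {n : ℕ} (hn : 2 ≤ n) (hμM : μ Mᶜ = 0)
    (hM : MeasurableSet M) (hφ : Measurable (M.indicator φ)) {κ : ℕ}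
    (hκ : ∀ (X : ℕ → E) (I : Finset ℕ) (j : ℕ) (S : Finset ℕ),
      (∀ i ∈ S, i ∈ I ∧ X i ≠ X j ∧ nnIndex X (I.erase i) (X i) = j) → S.card ≤ κ)
    {C : ℝ} (hC : ∀ x ∈ M, ∀ y ∈ M, |φ x - φ y| ≤ C)
    {D : ℝ} (hD : ∀ x y, |truncDiff φ M r x y| ≤ D) {m p : ℝ}
    (hm : ∀ y, μ.real (Metric.closedBall y r) ≤ m)
    (hp : ∀ x ∈ M, p ≤ μ.real (Metric.closedBall x r)) {η a : ℝ} (hη : 0 < η) (ha : 0 ≤ a) :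
    (Measure.pi fun _ : Fin n => μ) {z |
      ¬ (|estimateLoo μ φ (extendZero z) n - ∫ x, φ x ∂μ| ≤ a + C * η ∧
        |estimateNN μ φ (extendZero z) n - ∫ x, φ x ∂μ|
          ≤ a + C * η + 1 / (n : ℝ) * (2 * D + C * η))}
      ≤ ENNReal.ofReal (n * Real.exp (-((n - 1 : ℝ) * p)) + n * Real.exp (-((n - 1 : ℝ) * p)) / η
        + 2 * Real.exp (-a ^ 2 / (2 * (n * (4 * D / n * (κ + 2 + n * m)) ^ 2)))) := by
  set π := Measure.pi fun _ : Fin n => μ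
  set q := Real.exp (-((n - 1 : ℝ) * p)) with hq
  -- Outside these four bad events both error bounds hold deterministically.
  set A₁ : Set (Fin n → E) := {z | ¬ ∀ k < n, extendZero z k ∈ M} with hA₁
  set A₂ : Set (Fin n → E) := {z | ∃ i < n, IsFar r n (extendZero z) i (extendZero z i)} with hA₂
  set A₃ : Set (Fin n → E) := {z | ENNReal.ofReal η ≤ μ (farSet r n (extendZero z))} with hA₃
  set A₄ : Set (Fin n → E) := {z | a ≤ |truncError μ φ M r n (extendZero z)|} with hA₄
  have h₁ : π A₁ = 0 := ae_extendZero_mem hμM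
  have h₂ : π A₂ ≤ ENNReal.ofReal (n * q) := by
    rw [ENNReal.ofReal_mul (by positivity), ENNReal.ofReal_natCast]
    exact measure_exists_isFar_le hμM hp
  have h₃ : π A₃ ≤ ENNReal.ofReal (n * q / η) := by
    rw [ENNReal.ofReal_div_of_pos hη, ENNReal.ofReal_mul (by positivity), ENNReal.ofReal_natCast]
    exact measure_le_farSet_le hμM hp hη
  have h₄ : π A₄ ≤ ENNReal.ofReal
      (2 * Real.exp (-a ^ 2 / (2 * (n * (4 * D / n * (κ + 2 + n * m)) ^ 2)))) := by
    rw [← ofReal_measureReal]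
    exact ENNReal.ofReal_le_ofReal
      (measure_abs_truncError_ge_le hM hφ hκ hD hm (by omega) ha)
  rw [ENNReal.ofReal_add (by positivity) (by positivity),
    ENNReal.ofReal_add (by positivity) (by positivity)]
  have hsub : {z : Fin n → E |
      ¬ (|estimateLoo μ φ (extendZero z) n - ∫ x, φ x ∂μ| ≤ a + C * η ∧
        |estimateNN μ φ (extendZero z) n - ∫ x, φ x ∂μ|
          ≤ a + C * η + 1 / (n : ℝ) * (2 * D + C * η))} ⊆ A₁ ∪ (A₂ ∪ A₃ ∪ A₄) := by
    intro z hz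
    by_contra hnot
    simp only [Set.mem_union, not_or] at hnot
    obtain ⟨hz₁, ⟨hz₂, hz₃⟩, hz₄⟩ := hnot
    simp only [hA₁, hA₂, hA₃, hA₄, Set.mem_ofPred_eq, not_not, not_exists, not_and, not_le]
      at hz₁ hz₂ hz₃ hz₄
    have hfar : μ.real (farSet r n (extendZero z)) ≤ η :=
      ENNReal.toReal_le_of_le_ofReal hη.le hz₃.le
    have e1 := abs_estimateLoo_sub_integral_sub_truncError_le hn hμM hM hφ hC hD hz₁ hz₂ hfar
    have e2 := abs_estimateNN_sub_estimateLoo_le hn hμM hC hD hz₁ hfar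
    have e3 : |estimateLoo μ φ (extendZero z) n - ∫ x, φ x ∂μ| ≤ a + C * η := by
      have := abs_sub_abs_le_abs_sub (estimateLoo μ φ (extendZero z) n - ∫ x, φ x ∂μ)
        (truncError μ φ M r n (extendZero z))
      linarith
    refine hz ⟨e3, ?_⟩
    have := abs_sub_le (estimateNN μ φ (extendZero z) n) (estimateLoo μ φ (extendZero z) n)
      (∫ x, φ x ∂μ)
    linarith
  calc π _ ≤ π (A₁ ∪ (A₂ ∪ A₃ ∪ A₄)) := measure_mono hsub
    _ ≤ π A₁ + (π A₂ + π A₃ + π A₄) := by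
      refine (measure_union_le _ _).trans ?_
      gcongr
      refine (measure_union_le _ _).trans ?_
      gcongr
      exact measure_union_le _ _
    _ ≤ _ := by
      rw [h₁, zero_add]
      gcongr

end Concentration

/-! ### Ball masses under a regular density -/

section RegularDensity

variable {d : ℕ} {μ : Measure (EuclideanSpace ℝ (Fin d))} {M : Set (EuclideanSpace ℝ (Fin d))}
  {f : EuclideanSpace ℝ (Fin d) → ℝ} {b U c r₀ : ℝ}

lemma unitBallVolume_pos (d : ℕ) : 0 < unitBallVolume d :=
  ENNReal.toReal_pos (Metric.measure_closedBall_pos _ _ one_pos).ne' measure_closedBall_lt_top.ne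

lemma volume_closedBall_eq (x : EuclideanSpace ℝ (Fin d)) {r : ℝ} (hr : 0 ≤ r) :
    volume (Metric.closedBall x r) = ENNReal.ofReal (r ^ d * unitBallVolume d) := by
  rw [Measure.addHaar_closedBall' volume x hr, ENNReal.ofReal_mul (by positivity),
    finrank_euclideanSpace_fin, unitBallVolume, ENNReal.ofReal_toReal measure_closedBall_lt_top.ne]

lemma HasRegularDensity.measure_le (h : HasRegularDensity μ M f b U c r₀)
    (S : Set (EuclideanSpace ℝ (Fin d))) (hS : MeasurableSet S) :
    μ S ≤ ENNReal.ofReal U * volume S := by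
  have hM := h.isCompact.isClosed.measurableSet
  calc μ S = μ (S ∩ M) := (measure_inter_conull h.null_compl).symm
    _ = ∫⁻ x in S ∩ M, ENNReal.ofReal (f x) := by
        rw [h.eq_withDensity, withDensity_apply _ (hS.inter hM)]
    _ ≤ ∫⁻ _x in S ∩ M, ENNReal.ofReal U :=
        setLIntegral_mono measurable_const fun x hx => ENNReal.ofReal_le_ofReal (h.upper x hx.2)
    _ = ENNReal.ofReal U * volume (S ∩ M) := by rw [setLIntegral_const]
    _ ≤ _ := by gcongr; exact Set.inter_subset_left

lemma HasRegularDensity.measureReal_closedBall_le [IsProbabilityMeasure μ]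
    (h : HasRegularDensity μ M f b U c r₀) (hU : 0 ≤ U) (x : EuclideanSpace ℝ (Fin d)) {r : ℝ}
    (hr : 0 ≤ r) : μ.real (Metric.closedBall x r) ≤ U * (r ^ d * unitBallVolume d) := by
  have hV := unitBallVolume_pos d
  refine ENNReal.toReal_le_of_le_ofReal (by positivity) ?_
  rw [ENNReal.ofReal_mul hU, ← volume_closedBall_eq x hr]
  exact h.measure_le _ Metric.isClosed_closedBall.measurableSet

lemma HasRegularDensity.le_measureReal_closedBall [IsProbabilityMeasure μ]
    (h : HasRegularDensity μ M f b U c r₀) (hb : 0 ≤ b) (hc : 0 ≤ c)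
    {x : EuclideanSpace ℝ (Fin d)} (hx : x ∈ M) {r : ℝ} (hr : 0 < r) (hr₀ : r ≤ r₀) :
    b * c * (r ^ d * unitBallVolume d) ≤ μ.real (Metric.closedBall x r) := by
  have hV := unitBallVolume_pos d
  have hM := h.isCompact.isClosed.measurableSet
  rw [measureReal_def, ← ENNReal.ofReal_le_iff_le_toReal (measure_ne_top _ _)]
  have hS := hM.inter (Metric.isClosed_closedBall (x := x) (ε := r)).measurableSet
  calc ENNReal.ofReal (b * c * (r ^ d * unitBallVolume d))
      = ENNReal.ofReal b * (ENNReal.ofReal c * volume (Metric.closedBall x r)) := by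
        rw [volume_closedBall_eq x hr.le, mul_assoc, ENNReal.ofReal_mul hb, ENNReal.ofReal_mul hc]
    _ ≤ ENNReal.ofReal b * volume (M ∩ Metric.closedBall x r) := by
        gcongr; exact h.regular r hr hr₀ x hx
    _ = ∫⁻ _x in M ∩ Metric.closedBall x r, ENNReal.ofReal b := by rw [setLIntegral_const]
    _ ≤ ∫⁻ x in M ∩ Metric.closedBall x r, ENNReal.ofReal (f x) :=
        setLIntegral_mono h.measurable.ennreal_ofReal fun y hy =>
          ENNReal.ofReal_le_ofReal (h.lower y hy.1)
    _ = μ (M ∩ Metric.closedBall x r) := by rw [h.eq_withDensity, withDensity_apply _ hS]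
    _ ≤ μ (Metric.closedBall x r) := measure_mono Set.inter_subset_right

lemma HasRegularDensity.nonempty [IsProbabilityMeasure μ]
    (h : HasRegularDensity μ M f b U c r₀) : M.Nonempty := by
  rw [Set.nonempty_iff_ne_empty]
  rintro rfl
  have := h.null_compl
  simp at this

/-- `M` carries full mass and lies in a ball of radius its diameter, so a density bounded by `U`
prevents `M` from being small. -/
lemma HasRegularDensity.one_le_diam [IsProbabilityMeasure μ]
    (h : HasRegularDensity μ M f b U c r₀) (hU : 0 ≤ U) :
    1 ≤ U * (Metric.diam M ^ d * unitBallVolume d) := by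
  obtain ⟨x, hx⟩ := h.nonempty
  refine le_trans ?_ (h.measureReal_closedBall_le hU x Metric.diam_nonneg)
  have hsub : M ⊆ Metric.closedBall x (Metric.diam M) := fun y hy =>
    Metric.mem_closedBall.2 (Metric.dist_le_diam_of_mem h.isCompact.isBounded hy hx)
  have h1 : μ.real M = 1 := by
    have := (prob_compl_eq_zero_iff h.isCompact.isClosed.measurableSet).1 h.null_compl
    rw [measureReal_def, this, ENNReal.toReal_one]
  rw [← h1]
  exact measureReal_mono hsub

end RegularDensity

/-! ### Hölder functions on a compact set -/

section Holder

variable {E : Type*} [MetricSpace E] {φ : E → ℝ} {M : Set E} {L s : ℝ}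

lemma measurable_indicator_of_holder [MeasurableSpace E] [BorelSpace E] (hM : IsCompact M)
    (hs : 0 < s) (hφ : ∀ x ∈ M, ∀ y ∈ M, |φ x - φ y| ≤ L * dist x y ^ s) :
    Measurable (M.indicator φ) := by
  have hcont : ContinuousOn φ M := by
    intro x hx
    rw [ContinuousWithinAt, tendsto_iff_dist_tendsto_zero]
    refine squeeze_zero' (Filter.Eventually.of_forall fun _ => dist_nonneg)
      (g := fun y => L * dist y x ^ s) ?_ ?_
    · filter_upwards [self_mem_nhdsWithin] with y hy
      exact hφ y hy x hx
    · have : Filter.Tendsto (fun y => L * dist y x ^ s) (nhdsWithin x M)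
          (nhds (L * dist x x ^ s)) := by
        refine Filter.Tendsto.mono_left ?_ nhdsWithin_le_nhds
        refine Continuous.tendsto (f := fun y => L * dist y x ^ s) ?_ x
        exact continuous_const.mul
          ((continuous_id.dist continuous_const).rpow_const fun _ => Or.inr hs.le)
      simpa [Real.zero_rpow hs.ne'] using this
  have hMm := hM.isClosed.measurableSet
  classical
  rw [← Set.piecewise_eq_indicator]
  exact hcont.measurable_piecewise continuousOn_const hMm

lemma abs_truncDiff_le_of_holder {r : ℝ} (hr : 0 ≤ r) (hL : 0 ≤ L) (hs : 0 ≤ s)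
    (hφ : ∀ x ∈ M, ∀ y ∈ M, |φ x - φ y| ≤ L * dist x y ^ s) (x y : E) :
    |truncDiff φ M r x y| ≤ L * r ^ s := by
  unfold truncDiff
  split_ifs with h
  · rw [abs_sub_comm]
    refine (hφ x h.1 y h.2.1).trans ?_
    gcongr
    exact h.2.2
  · rw [abs_zero]; positivity

lemma abs_sub_le_diam_of_holder (hM : IsCompact M) (hL : 0 ≤ L) (hs : 0 ≤ s)
    (hφ : ∀ x ∈ M, ∀ y ∈ M, |φ x - φ y| ≤ L * dist x y ^ s) :
    ∀ x ∈ M, ∀ y ∈ M, |φ x - φ y| ≤ L * Metric.diam M ^ s := by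
  intro x hx y hy
  refine (hφ x hx y hy).trans ?_
  gcongr
  exact Metric.dist_le_diam_of_mem hM.isBounded hx hy

end Holder

lemma abs_sub_le_two_mul_halfRange {E : Type*} {φ : E → ℝ} {M : Set E} {C : ℝ} (hC : ∀ x ∈ M, ∀ y ∈ M, |φ x - φ y| ≤ C) :
    ∀ x ∈ M, ∀ y ∈ M, |φ x - φ y| ≤ 2 * halfRange φ M := by
  intro x hx y hy
  have hab : BddAbove (φ '' M) := ⟨φ x + C, by
    rintro _ ⟨z, hz, rfl⟩
    have := (abs_le.1 (hC z hz x hx)).2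
    linarith⟩
  have hbe : BddBelow (φ '' M) := ⟨φ x - C, by
    rintro _ ⟨z, hz, rfl⟩
    have := (abs_le.1 (hC z hz x hx)).1
    linarith⟩
  have h1 := le_csSup hab (Set.mem_image_of_mem φ hx)
  have h2 := le_csSup hab (Set.mem_image_of_mem φ hy)
  have h3 := csInf_le hbe (Set.mem_image_of_mem φ hx)
  have h4 := csInf_le hbe (Set.mem_image_of_mem φ hy)
  unfold halfRange
  rw [abs_le]
  constructor <;> linarith

/-! ### Logarithms, rates and the choice of constants -/

section Numerics

variable {d n : ℕ} {s ε : ℝ}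

/-- Here `log 2 ≥ 1/4` suffices. The bound lets terms without this factor be absorbed into the
deviation term. -/
lemma half_le_sqrt_log (hε : 0 < ε) (hε1 : ε < 1) :
    1 / 2 ≤ Real.sqrt (Real.log (2 / Real.sqrt ε)) := by
  refine Real.le_sqrt_of_sq_le ?_
  have h1 : Real.sqrt ε ≤ 1 := Real.sqrt_le_one.2 hε1.le
  have h2 : 0 < Real.sqrt ε := Real.sqrt_pos.2 hε
  have h3 : Real.log 2 ≤ Real.log (2 / Real.sqrt ε) :=
    Real.log_le_log two_pos (by rw [le_div_iff₀ h2]; linarith)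
  have := Real.log_two_gt_d9
  linarith

lemma log_two_div_sqrt (hε : 0 < ε) : Real.log (2 / Real.sqrt ε) = Real.log (4 / ε) / 2 := by
  have h2 : 0 < Real.sqrt ε := Real.sqrt_pos.2 hε
  have : (4 / ε) = (2 / Real.sqrt ε) ^ 2 := by
    rw [div_pow, Real.sq_sqrt hε.le]; norm_num
  rw [this, Real.log_pow]
  push_cast
  ring

lemma one_le_log_div_min {N : ℝ} (hn : 2 ≤ n) (hε : 0 < ε) (hε1 : ε < 1) (hN : 0 < N) :
    1 ≤ Real.log (12 * (n : ℝ) / min (ε / 2) (1 / N)) := by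
  have hn' : (2 : ℝ) ≤ n := by exact_mod_cast hn
  have hδ : 0 < min (ε / 2) (1 / N) := lt_min (by positivity) (by positivity)
  have hδ1 : min (ε / 2) (1 / N) ≤ 1 := (min_le_left _ _).trans (by linarith)
  rw [Real.le_log_iff_exp_le (by positivity), le_div_iff₀ hδ]
  have := Real.exp_one_lt_d9
  nlinarith [Real.exp_pos 1]

/-- The two cases of `deviation` tell which entry of the minimum is smaller. If it is `ε / 2`, the
logarithms agree; if it is `1 / N`, then `N ≤ n ^ 2` gives `12 n N ≤ (3 n) ^ 3`. The summand
`n^(-s/d)` is simply dropped. -/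
lemma le_deviation (ht0 : 0 ≤ s / d) (ht1 : s / d ≤ 1) (hn : 2 ≤ n) (hε : 0 < ε) (hε1 : ε < 1) :
    Real.sqrt (Real.log (2 / Real.sqrt ε)) / (n : ℝ) ^ (1 / 2 + s / (d : ℝ)) *
      Real.log (12 * (n : ℝ) / min (ε / 2) (1 / (n : ℝ) ^ (1 / 2 + s / (d : ℝ)))) ^
        (1 + s / (d : ℝ)) ≤ deviation d n s ε := by
  have hn' : (2 : ℝ) ≤ n := by exact_mod_cast hn
  set t := s / (d : ℝ) with ht
  set N := (n : ℝ) ^ (1 / 2 + t) with hN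
  have hN0 : 0 < N := by positivity
  have hℓ := one_le_log_div_min (N := N) hn hε hε1 hN0
  unfold deviation
  rw [← ht, ← hN]
  refine mul_le_mul ?_ ?_ (by positivity) (by positivity)
  · gcongr
    have : 0 ≤ 1 / (n : ℝ) ^ t := by positivity
    linarith
  split_ifs with h
  · have : min (ε / 2) (1 / N) = ε / 2 := by
      refine min_eq_left ?_
      have e : 2 / N = 2 * (1 / N) := by ring
      linarith
    rw [this]
    refine le_of_eq ?_
    congr 2
    field_simp
    ring
  · have : min (ε / 2) (1 / N) = 1 / N := by
      refine min_eq_right ?_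
      have e : 2 / N = 2 * (1 / N) := by ring
      linarith [not_le.1 h]
    rw [this] at hℓ ⊢
    have hNle : N ≤ (n : ℝ) ^ 2 := by
      rw [hN, ← Real.rpow_natCast]
      refine Real.rpow_le_rpow_of_exponent_le (by linarith) ?_
      push_cast
      linarith
    refine Real.rpow_le_rpow (by linarith) ?_ (by linarith)
    have e : 3 * Real.log (3 * (n : ℝ)) = Real.log ((3 * n) ^ 3) := by
      rw [Real.log_pow]; push_cast; ring
    rw [e]
    refine Real.log_le_log (by positivity) ?_
    rw [div_div_eq_mul_div, div_one]
    nlinarith [mul_le_mul_of_nonneg_left hNle (show (0 : ℝ) ≤ 12 * n by positivity),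
      show (0 : ℝ) ≤ (n : ℝ) ^ 3 by positivity]

lemma deviation_nonneg (ht0 : 0 ≤ s / d) (ht1 : s / d ≤ 1) (hn : 2 ≤ n) (hε : 0 < ε)
    (hε1 : ε < 1) : 0 ≤ deviation d n s ε := by
  refine le_trans ?_ (le_deviation ht0 ht1 hn hε hε1)
  have := one_le_log_div_min (N := (n : ℝ) ^ (1 / 2 + s / (d : ℝ))) hn hε hε1 (by positivity)
  positivity

/-- Since `n - 1 ≥ n / 2`, the exponential is at most `exp (-2ℓ) = (δ / (12 n)) ^ 2`. One factor `δ
≤ η` pays for the division in Markov's inequality, the other for `ε`. -/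
lemma far_probability_le {η ℓ p : ℝ} (hn : 2 ≤ n) (hε : 0 < ε) (hε1 : ε < 1) (hη : 0 < η)
    (hℓ : ℓ = Real.log (12 * (n : ℝ) / min (ε / 2) η)) (hℓ1 : 1 ≤ ℓ) (hp : 4 * ℓ ≤ n * p) :
    n * Real.exp (-((n - 1 : ℝ) * p)) + n * Real.exp (-((n - 1 : ℝ) * p)) / η ≤ ε / 2 := by
  have hn' : (2 : ℝ) ≤ n := by exact_mod_cast hn
  set δ := min (ε / 2) η with hδdef
  have hδ : 0 < δ := lt_min (by positivity) hη
  have hδε : δ ≤ ε / 2 := min_le_left _ _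
  have hδη : δ ≤ η := min_le_right _ _
  have hp0 : 0 ≤ p := by
    by_contra h
    nlinarith
  have hexp : Real.exp (-((n - 1 : ℝ) * p)) ≤ (δ / (12 * n)) ^ 2 := by
    have h1 : -((n - 1 : ℝ) * p) ≤ -(2 * ℓ) := by nlinarith
    refine (Real.exp_le_exp.2 h1).trans (le_of_eq ?_)
    rw [show -(2 * ℓ) = ((2 : ℕ) : ℝ) * (-ℓ) by push_cast; ring, Real.exp_nat_mul, Real.exp_neg,
      hℓ, Real.exp_log (by positivity), inv_div]
  set q := Real.exp (-((n - 1 : ℝ) * p)) with hq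
  have hq0 : 0 < q := Real.exp_pos _
  have hnq : n * q ≤ δ ^ 2 / 4 := by
    calc n * q ≤ n * (δ / (12 * n)) ^ 2 := by gcongr
      _ = δ ^ 2 / (144 * n) := by field_simp; norm_num
      _ ≤ δ ^ 2 / 4 := by gcongr; linarith
  have h1 : n * q / η ≤ δ / 4 := by
    rw [div_le_iff₀ hη]
    nlinarith
  nlinarith

end Numerics

/-- In the application `H * ℓ / n` is `r ^ d`, `t = s / d`, `G * ℓ` is `n * m` and `σ` is the square
root in `deviation`. The first bound is for the McDiarmid deviation, the second for the gap between
the two estimates; `ℓ ≥ 1` and `σ ≥ 1/2` bring both to the same form. -/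
lemma rate_bounds {t ℓ σ H L κ G : ℝ} {n : ℕ} (hn : 2 ≤ n) (hℓ : 1 ≤ ℓ) (hσ : 1 / 2 ≤ σ)
    (hH : 0 < H) (hL : 0 < L) (hκ : 0 ≤ κ) (hG : 0 ≤ G) :
    4 * (L * (H * ℓ / n) ^ t) / n * (κ + 2 + G * ℓ) * (2 * Real.sqrt n * σ)
        ≤ 8 * L * H ^ t * (κ + 2 + G) * (σ / (n : ℝ) ^ (1 / 2 + t) * ℓ ^ (1 + t)) ∧
      1 / (n : ℝ) * (2 * (L * (H * ℓ / n) ^ t))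
        ≤ 8 * L * H ^ t * (κ + 2 + G) * (σ / (n : ℝ) ^ (1 / 2 + t) * ℓ ^ (1 + t)) := by
  have hn' : (2 : ℝ) ≤ n := by exact_mod_cast hn
  have hn0 : (0 : ℝ) < n := by linarith
  have hℓ0 : 0 < ℓ := by linarith
  have hσ0 : 0 < σ := by linarith
  have h1 : (H * ℓ / n) ^ t = H ^ t * ℓ ^ t / (n : ℝ) ^ t := by
    rw [Real.div_rpow (by positivity) hn0.le, Real.mul_rpow hH.le hℓ0.le]
  have h2 : (n : ℝ) ^ (1 / 2 + t) = Real.sqrt n * (n : ℝ) ^ t := by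
    rw [Real.rpow_add hn0, Real.sqrt_eq_rpow]
  have h3 : ℓ ^ (1 + t) = ℓ * ℓ ^ t := by rw [Real.rpow_add hℓ0, Real.rpow_one]
  have h4 : (n : ℝ) = Real.sqrt n * Real.sqrt n := (Real.mul_self_sqrt hn0.le).symm
  have hr : 1 ≤ Real.sqrt n := Real.one_le_sqrt.2 (by linarith)
  rw [h1, h2, h3]
  set R := Real.sqrt n
  set T := (n : ℝ) ^ t
  have hT : 0 < T := by positivity
  have hR : 0 < R := by linarith
  rw [h4]
  have hHt : 0 < H ^ t := by positivity
  have hℓt : 0 < ℓ ^ t := by positivity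
  constructor
  · have e : 4 * (L * (H ^ t * ℓ ^ t / T)) / (R * R) * (κ + 2 + G * ℓ) * (2 * R * σ)
        = 8 * L * H ^ t * (σ / (R * T) * ℓ ^ t) * (κ + 2 + G * ℓ) := by field_simp; ring
    have e' : 8 * L * H ^ t * (κ + 2 + G) * (σ / (R * T) * (ℓ * ℓ ^ t))
        = 8 * L * H ^ t * (σ / (R * T) * ℓ ^ t) * ((κ + 2 + G) * ℓ) := by ring
    rw [e, e']
    gcongr
    nlinarith
  · have e : 1 / (R * R) * (2 * (L * (H ^ t * ℓ ^ t / T)))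
        = 8 * L * H ^ t * (1 / (R * T) * ℓ ^ t) * (1 / (4 * R)) := by field_simp; norm_num
    have e' : 8 * L * H ^ t * (κ + 2 + G) * (σ / (R * T) * (ℓ * ℓ ^ t))
        = 8 * L * H ^ t * (1 / (R * T) * ℓ ^ t) * (σ * ((κ + 2 + G) * ℓ)) := by ring
    rw [e, e']
    gcongr
    have h5 : 1 / (4 * R) ≤ 1 := by
      rw [div_le_one (by positivity)]
      linarith
    have h6 : 2 ≤ (κ + 2 + G) * ℓ := by nlinarith
    nlinarith

/-! ### The two sample size regimes and the theorem -/

section Main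

variable {d : ℕ} {b U c L s : ℝ} {κ : ℕ} {Ω : Type*} [MeasurableSpace Ω] {P : Measure Ω}
  [IsProbabilityMeasure P] {μ : Measure (EuclideanSpace ℝ (Fin d))} [IsProbabilityMeasure μ]
  {M : Set (EuclideanSpace ℝ (Fin d))} {f : EuclideanSpace ℝ (Fin d) → ℝ} {r₀ : ℝ}
  {X : ℕ → Ω → EuclideanSpace ℝ (Fin d)} {φ : EuclideanSpace ℝ (Fin d) → ℝ} {n : ℕ} {ε : ℝ}

/-- The concentration bound for samples large enough with respect to `r₀`. -/
lemma le_measure_deviationEvent_of_large (hd : 0 < d) (hb : 0 < b) (hbU : b ≤ U) (hc : 0 < c)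
    (hL : 0 < L) (hs : 0 < s) (hs1 : s ≤ 1)
    (hκ : ∀ (X : ℕ → EuclideanSpace ℝ (Fin d)) (I : Finset ℕ) (j : ℕ) (S : Finset ℕ),
      (∀ i ∈ S, i ∈ I ∧ X i ≠ X j ∧ nnIndex X (I.erase i) (X i) = j) → S.card ≤ κ)
    (hr₀ : 0 < r₀) (h : HasRegularDensity μ M f b U c r₀)
    (hX : ∀ i, Measurable (X i)) (hind : iIndepFun X P) (hlaw : ∀ i, P.map (X i) = μ)
    (hφ : ∀ x ∈ M, ∀ y ∈ M, |φ x - φ y| ≤ L * dist x y ^ s)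
    (hn : 2 ≤ n) (hε : 0 < ε) (hε1 : ε < 1)
    (hlarge : 8 * (d : ℝ) * Real.log (12 * (n : ℝ) / min (ε / 2)
        (1 / (n : ℝ) ^ (1 / 2 + s / (d : ℝ)))) ≤ r₀ ^ d * (n : ℝ) * b * c * unitBallVolume d / 2)
    {K₁ K₂ : ℝ}
    (hK₁ : 8 * L * (16 * d / (b * c * unitBallVolume d)) ^ (s / (d : ℝ))
      * (κ + 2 + 16 * d * U / (b * c)) ≤ K₁)
    (hK₂ : 2 * (8 * L * (16 * d / (b * c * unitBallVolume d)) ^ (s / (d : ℝ))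
      * (κ + 2 + 16 * d * U / (b * c))) ≤ K₂) :
    ENNReal.ofReal (1 - ε) ≤ P (deviationEvent μ M φ X b c L s n ε K₁ K₂) := by
  have hV := unitBallVolume_pos d
  have hU : 0 < U := hb.trans_le hbU
  have hd' : (1 : ℝ) ≤ d := by exact_mod_cast hd
  have hd0 : (0 : ℝ) < d := by linarith
  have hn' : (2 : ℝ) ≤ n := by exact_mod_cast hn
  have ht0 : 0 ≤ s / (d : ℝ) := by positivity
  have ht1 : s / (d : ℝ) ≤ 1 := (div_le_one hd0).2 (by linarith)
  have hdev := le_deviation ht0 ht1 hn hε hε1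
  set N := (n : ℝ) ^ (1 / 2 + s / (d : ℝ)) with hN
  have hN0 : 0 < N := by positivity
  have hℓ1 := one_le_log_div_min (N := N) hn hε hε1 hN0
  set ℓ := Real.log (12 * (n : ℝ) / min (ε / 2) (1 / N)) with hℓ
  have hσ := half_le_sqrt_log hε hε1
  set σ := Real.sqrt (Real.log (2 / Real.sqrt ε)) with hσdef
  set V := unitBallVolume d with hVdef
  set H := 16 * d / (b * c * V) with hHdef
  have hH : 0 < H := by positivity
  set G := 16 * d * U / (b * c) with hGdef
  have hG : 0 < G := by positivity
  -- With this `r`, `n` times the lower bound for the mass of a ball is `16 * d * ℓ`, and the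
  -- hypothesis `hlarge` says exactly that `r ≤ r₀`.
  set r := (H * ℓ / n) ^ (1 / (d : ℝ)) with hrdef
  have hy : 0 < H * ℓ / n := by positivity
  have hr : 0 < r := by positivity
  have hrd : r ^ d = H * ℓ / n := by
    rw [hrdef, ← Real.rpow_natCast, ← Real.rpow_mul hy.le, one_div_mul_cancel hd0.ne',
      Real.rpow_one]
  have hrs : r ^ s = (H * ℓ / n) ^ (s / (d : ℝ)) := by
    rw [hrdef, ← Real.rpow_mul hy.le]
    congr 1
    ring
  have hrr₀ : r ≤ r₀ := by
    rw [← pow_le_pow_iff_left₀ hr.le hr₀.le hd.ne', hrd, hHdef, div_mul_eq_mul_div, div_div,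
      div_le_iff₀ (by positivity)]
    linarith
  have hM := h.isCompact.isClosed.measurableSet
  have hφm := measurable_indicator_of_holder h.isCompact hs hφ
  have hC := abs_sub_le_two_mul_halfRange
    (abs_sub_le_diam_of_holder h.isCompact hL.le hs.le hφ)
  have hC0 : 0 ≤ halfRange φ M := by
    obtain ⟨x, hx⟩ := h.nonempty
    have := (abs_nonneg _).trans (hC x hx x hx)
    linarith
  have hD := abs_truncDiff_le_of_holder (φ := φ) hr.le hL.le hs.le hφ
  rw [hrs] at hD
  have hD0 : 0 < L * (H * ℓ / n) ^ (s / (d : ℝ)) := by positivity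
  set D := L * (H * ℓ / n) ^ (s / (d : ℝ)) with hDdef
  have hm : ∀ y, μ.real (Metric.closedBall y r) ≤ U * (H * ℓ / n * V) := fun y => by
    rw [← hrd]; exact h.measureReal_closedBall_le hU.le y hr.le
  have hp : ∀ x ∈ M, b * c * (H * ℓ / n * V) ≤ μ.real (Metric.closedBall x r) := fun x hx => by
    rw [← hrd]; exact h.le_measureReal_closedBall hb.le hc.le hx hr hrr₀
  have hnm : (n : ℝ) * (U * (H * ℓ / n * V)) = G * ℓ := by
    rw [hHdef, hGdef]; field_simp
  have hnp : (n : ℝ) * (b * c * (H * ℓ / n * V)) = 16 * d * ℓ := by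
    rw [hHdef]; field_simp
  set m := U * (H * ℓ / n * V)
  set p := b * c * (H * ℓ / n * V)
  have hw0 : 0 < 4 * D / n * (κ + 2 + G * ℓ) := by positivity
  set w := 4 * D / n * (κ + 2 + G * ℓ) with hw
  have hbad := measure_not_estimate_le hn h.null_compl hM hφm hκ hC hD hm hp
    (η := 1 / N) (a := w * (2 * Real.sqrt n * σ)) (by positivity) (by positivity)
  rw [hnm, ← hw] at hbad
  obtain ⟨hrate₁, hrate₂⟩ := rate_bounds (t := s / (d : ℝ)) (κ := κ) hn hℓ1 hσ hH hL
    (Nat.cast_nonneg κ) hG.le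
  rw [← hDdef, ← hw, ← hN] at hrate₁
  rw [← hDdef, ← hN] at hrate₂
  set K := 8 * L * H ^ (s / (d : ℝ)) * (κ + 2 + G) with hK
  have hK0 : 0 < K := by positivity
  have hprob : n * Real.exp (-((n - 1 : ℝ) * p)) + n * Real.exp (-((n - 1 : ℝ) * p)) / (1 / N)
      ≤ ε / 2 := by
    refine far_probability_le hn hε hε1 (by positivity) hℓ hℓ1 ?_
    rw [hnp]
    nlinarith
  clear_value w σ
  -- The level `2 * √n * σ * w` makes the exponent `-2 * σ ^ 2 = -log (4 / ε)`, leaving half of `ε`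
  -- to the remote neighbors.
  have htail : 2 * Real.exp (-(w * (2 * Real.sqrt n * σ)) ^ 2 / (2 * (n * w ^ 2))) = ε / 2 := by
    have hσ2 : σ ^ 2 = Real.log (4 / ε) / 2 := by
      rw [← log_two_div_sqrt hε, hσdef, Real.sq_sqrt]
      by_contra hneg
      rw [hσdef, Real.sqrt_eq_zero_of_nonpos (not_le.1 hneg).le] at hσ
      linarith
    have e : -(w * (2 * Real.sqrt n * σ)) ^ 2 / (2 * (n * w ^ 2)) = -Real.log (4 / ε) := by
      rw [mul_pow, mul_pow, mul_pow, Real.sq_sqrt (Nat.cast_nonneg n), hσ2]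
      field_simp
    rw [e, Real.exp_neg, Real.exp_log (by positivity)]
    field_simp
    norm_num
  refine ofReal_one_sub_le_measure hX hind hlaw (n := n) hε.le
    (hbad.trans (ENNReal.ofReal_le_ofReal (by linarith))) fun ω hω => ?_
  have hcongr : ∀ k < n, extendZero (fun i : Fin n => X i ω) k = X k ω := fun k hk =>
    extendZero_val (fun i : Fin n => X i ω) ⟨k, hk⟩
  rw [estimateLoo_congr μ φ hn hcongr, estimateNN_congr μ φ hn hcongr] at hω
  have hdev0 := deviation_nonneg ht0 ht1 hn hε hε1
  have hKdev := mul_le_mul_of_nonneg_left hdev hK0.le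
  have hK₁dev := mul_le_mul_of_nonneg_right hK₁ hdev0
  have hK₂dev := mul_le_mul_of_nonneg_right hK₂ hdev0
  have hCN : 0 ≤ halfRange φ M / N := by positivity
  -- With oscillation `2 C_φ` and `η = 1 / N`, the far sets cost `2 C_φ / N` for each estimate and
  -- at most as much again for their difference: 4 in place of the allowed 6.
  have hCN1 : 1 / (n : ℝ) * (2 * halfRange φ M * (1 / N)) ≤ 2 * (halfRange φ M / N) := by
    have h1 : 1 / (n : ℝ) ≤ 1 := by
      rw [div_le_one (by linarith)]
      linarith
    calc _ ≤ 1 * (2 * halfRange φ M * (1 / N)) := by gcongr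
      _ = _ := by ring
  have e1 : 2 * halfRange φ M * (1 / N) = 2 * (halfRange φ M / N) := by ring
  have e2 : 6 * halfRange φ M / N = 6 * (halfRange φ M / N) := by ring
  -- Only the sign of this last term is used; the `2D / n` part of the gap between the estimates is
  -- covered by doubling `K`.
  have hlast : 0 ≤ (s / (d : ℝ) + 2) * L * (V * b * c) ^ (-(s / (d : ℝ)))
      / (n : ℝ) ^ (1 + s / (d : ℝ)) := by positivity
  change _ ∧ _
  rw [← hN, ← hVdef, e2]
  rw [mul_add, e1] at hω
  rw [e1] at hCN1
  constructor
  · linarith [hω.1]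
  · linarith [hω.2]

/-- The concentration bound for samples that are small with respect to `r₀`: here the error is
bounded almost surely in terms of the diameter of `M`. -/
lemma le_measure_deviationEvent_of_small (hd : 0 < d) (hb : 0 < b) (hbU : b ≤ U) (hc : 0 < c)
    (hL : 0 < L) (hs : 0 < s) (hs1 : s ≤ 1)
    (hr₀ : 0 < r₀) (h : HasRegularDensity μ M f b U c r₀)
    (hX : ∀ i, Measurable (X i)) (hind : iIndepFun X P) (hlaw : ∀ i, P.map (X i) = μ)
    (hφ : ∀ x ∈ M, ∀ y ∈ M, |φ x - φ y| ≤ L * dist x y ^ s)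
    (hn : 2 ≤ n) (hε : 0 < ε) (hε1 : ε < 1)
    (hsmall : r₀ ^ d * (n : ℝ) * b * c * unitBallVolume d / 2 < 8 * (d : ℝ) *
      Real.log (12 * (n : ℝ) / min (ε / 2) (1 / (n : ℝ) ^ (1 / 2 + s / (d : ℝ)))))
    {K₁ K₂ q : ℝ} (hq : q = Metric.diam M / r₀)
    (hK₁ : 4 * L * (|q| ^ s * (16 * d / (b * c * unitBallVolume d)) ^ (s / (d : ℝ)))
      * Real.sqrt (U * unitBallVolume d * (|q| ^ d * (16 * d / (b * c * unitBallVolume d)))) ≤ K₁)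
    (hK₂ : 4 * L * (|q| ^ s * (16 * d / (b * c * unitBallVolume d)) ^ (s / (d : ℝ)))
      * Real.sqrt (U * unitBallVolume d * (|q| ^ d * (16 * d / (b * c * unitBallVolume d)))) ≤ K₂) :
    ENNReal.ofReal (1 - ε) ≤ P (deviationEvent μ M φ X b c L s n ε K₁ K₂) := by
  have hV := unitBallVolume_pos d
  have hU : 0 < U := hb.trans_le hbU
  have hd' : (1 : ℝ) ≤ d := by exact_mod_cast hd
  have hd0 : (0 : ℝ) < d := by linarith
  have hn' : (2 : ℝ) ≤ n := by exact_mod_cast hn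
  have ht0 : 0 ≤ s / (d : ℝ) := by positivity
  have ht1 : s / (d : ℝ) ≤ 1 := (div_le_one hd0).2 (by linarith)
  have hdev := le_deviation ht0 ht1 hn hε hε1
  set N := (n : ℝ) ^ (1 / 2 + s / (d : ℝ)) with hN
  have hN0 : 0 < N := by positivity
  have hℓ1 := one_le_log_div_min (N := N) hn hε hε1 hN0
  set ℓ := Real.log (12 * (n : ℝ) / min (ε / 2) (1 / N)) with hℓ
  have hσ := half_le_sqrt_log hε hε1
  set σ := Real.sqrt (Real.log (2 / Real.sqrt ε)) with hσdef
  have hone := h.one_le_diam hU.le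
  set V := unitBallVolume d with hVdef
  set H := 16 * d / (b * c * V) with hHdef
  have hH : 0 < H := by positivity
  have hq0 : 0 ≤ q := hq ▸ div_nonneg Metric.diam_nonneg hr₀.le
  rw [abs_of_nonneg hq0] at hK₁ hK₂
  have hdiam : Metric.diam M = q * r₀ := by rw [hq, div_mul_cancel₀ _ hr₀.ne']
  have hy : 0 < H * ℓ / n := by positivity
  have hr₀d : r₀ ^ d ≤ H * ℓ / n := by
    rw [hHdef, div_mul_eq_mul_div, div_div, le_div_iff₀ (by positivity)]
    linarith
  have hr₀s : r₀ ^ s ≤ (H * ℓ / n) ^ (s / (d : ℝ)) := by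
    have : r₀ ^ s = (r₀ ^ d) ^ (s / (d : ℝ)) := by
      rw [← Real.rpow_natCast, ← Real.rpow_mul hr₀.le, mul_div_cancel₀ _ hd0.ne']
    rw [this]
    gcongr
  have hdiams : Metric.diam M ^ s ≤ q ^ s * (H * ℓ / n) ^ (s / (d : ℝ)) := by
    rw [hdiam, Real.mul_rpow hq0 hr₀.le]
    gcongr
  -- Since `diam M = q * r₀` and `r₀ ^ d ≤ H * ℓ / n`, the lower bound on the diameter bounds 1 by a
  -- constant times `ℓ / n`. Its square root supplies the `n^(-1/2)` that the oscillation bound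
  -- lacks.
  have hsqrt : 1 ≤ Real.sqrt (U * V * (q ^ d * H)) * Real.sqrt (ℓ / n) := by
    rw [← Real.sqrt_mul (by positivity)]
    refine Real.one_le_sqrt.2 (hone.trans ?_)
    rw [hdiam, mul_pow]
    calc U * (q ^ d * r₀ ^ d * V) ≤ U * (q ^ d * (H * ℓ / n) * V) := by gcongr
      _ = _ := by ring
  have hC := abs_sub_le_diam_of_holder h.isCompact hL.le hs.le hφ
  have hφm := measurable_indicator_of_holder h.isCompact hs hφ
  set B := Real.sqrt (U * V * (q ^ d * H)) with hB
  have hB0 : 0 ≤ B := Real.sqrt_nonneg _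
  have hmain : 2 * (L * Metric.diam M ^ s) ≤ 4 * L * (q ^ s * H ^ (s / (d : ℝ))) * B
      * (σ / N * ℓ ^ (1 + s / (d : ℝ))) := by
    have hℓ0 : 0 < ℓ := by linarith
    have hn0 : (0 : ℝ) < n := by linarith
    have h1 : (H * ℓ / n) ^ (s / (d : ℝ))
        = H ^ (s / (d : ℝ)) * ℓ ^ (s / (d : ℝ)) / (n : ℝ) ^ (s / (d : ℝ)) := by
      rw [Real.div_rpow (by positivity) hn0.le, Real.mul_rpow hH.le hℓ0.le]
    have h2 : N = Real.sqrt n * (n : ℝ) ^ (s / (d : ℝ)) := by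
      rw [hN, Real.rpow_add hn0, Real.sqrt_eq_rpow]
    have h3 : ℓ ^ (1 + s / (d : ℝ)) = ℓ * ℓ ^ (s / (d : ℝ)) := by
      rw [Real.rpow_add hℓ0, Real.rpow_one]
    have hsℓ : Real.sqrt ℓ ≤ ℓ := by
      rw [Real.sqrt_le_left hℓ0.le]
      nlinarith
    have hsq : 1 ≤ B * (ℓ / Real.sqrt n) := by
      refine hsqrt.trans ?_
      rw [Real.sqrt_div hℓ0.le]
      gcongr
    have hrn : 0 < Real.sqrt n := Real.sqrt_pos.2 hn0
    have hring : ∀ a Ht ℓt nt R : ℝ, 2 * (L * (a * (Ht * ℓt / nt))) * (2 * σ * (B * (ℓ / R)))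
        = 4 * L * (a * Ht) * B * (σ / (R * nt) * (ℓ * ℓt)) := fun a Ht ℓt nt R => by ring
    calc 2 * (L * Metric.diam M ^ s)
        ≤ 2 * (L * (q ^ s * (H * ℓ / n) ^ (s / (d : ℝ)))) * 1 := by
          rw [mul_one]; gcongr
      _ ≤ 2 * (L * (q ^ s * (H * ℓ / n) ^ (s / (d : ℝ)))) * (2 * σ * (B * (ℓ / Real.sqrt n))) := by
          refine mul_le_mul_of_nonneg_left ?_ (by positivity)
          have h4 : 1 ≤ 2 * σ := by linarith
          exact one_le_mul_of_one_le_of_one_le h4 hsq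
      _ = _ := by rw [h1, h2, h3, hring]
  have hdev0 := deviation_nonneg ht0 ht1 hn hε hε1
  set K := 4 * L * (q ^ s * H ^ (s / (d : ℝ))) * B with hK
  have hK0 : 0 ≤ K := by positivity
  have hKdev := mul_le_mul_of_nonneg_left hdev hK0
  have hK₁dev := mul_le_mul_of_nonneg_right hK₁ hdev0
  have hK₂dev := mul_le_mul_of_nonneg_right hK₂ hdev0
  have hCr : 0 ≤ halfRange φ M := by
    obtain ⟨x, hx⟩ := h.nonempty
    have := (abs_nonneg _).trans (abs_sub_le_two_mul_halfRange hC x hx x hx)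
    linarith
  have hCN : 0 ≤ 6 * halfRange φ M / N := by positivity
  have hlast : 0 ≤ (s / (d : ℝ) + 2) * L * (V * b * c) ^ (-(s / (d : ℝ)))
      / (n : ℝ) ^ (1 + s / (d : ℝ)) := by positivity
  refine ofReal_one_sub_le_measure hX hind hlaw (n := n)
    (Q := fun z => ∀ k < n, extendZero z k ∈ M) hε.le ?_ fun ω hω => ?_
  · have h0 : (Measure.pi fun _ : Fin n => μ) {z | ¬ ∀ k < n, extendZero z k ∈ M} = 0 :=
      ae_extendZero_mem h.null_compl
    rw [h0]
    exact zero_le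
  · have hXM : ∀ k < n, X k ω ∈ M := fun k hk => by
      have := hω k hk
      rwa [extendZero_val (fun i : Fin n => X i ω) ⟨k, hk⟩] at this
    obtain ⟨h1, h2⟩ := abs_estimate_sub_integral_le (X := fun i => X i ω) hn h.null_compl hφm hC hXM
    change _ ∧ _
    rw [← hN, ← hVdef]
    constructor <;> linarith

end Main

theorem theorem2 (d : ℕ) (hd : 0 < d) (b U c L s : ℝ)
    (hb : 0 < b) (hbU : b ≤ U) (hc : 0 < c) (hL : 0 < L) (hs : 0 < s) (hs1 : s ≤ 1) :
    -- `K₁`, `K₂` depend on `b, c, d, L, s, U` only; `K₁'`, `K₂'` may depend on `diam M / r₀` too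
    ∃ (K₁ K₂ : ℝ) (K₁' K₂' : ℝ → ℝ),
      0 < K₁ ∧ 0 < K₂ ∧ (∀ q, 0 < K₁' q) ∧ (∀ q, 0 < K₂' q) ∧
      ∀ {Ω : Type*} [MeasurableSpace Ω] (P : Measure Ω) [IsProbabilityMeasure P]
        (μ : Measure (EuclideanSpace ℝ (Fin d))) [IsProbabilityMeasure μ]
        (M : Set (EuclideanSpace ℝ (Fin d))) (f : EuclideanSpace ℝ (Fin d) → ℝ)
        (r₀ : ℝ) (_ : 0 < r₀) (_ : HasRegularDensity μ M f b U c r₀)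
        (X : ℕ → Ω → EuclideanSpace ℝ (Fin d)) (_ : ∀ i, Measurable (X i))
        (_ : iIndepFun X P) (_ : ∀ i, P.map (X i) = μ)
        (φ : EuclideanSpace ℝ (Fin d) → ℝ)
        (_ : ∀ x ∈ M, ∀ y ∈ M, |φ x - φ y| ≤ L * dist x y ^ s)
        (n : ℕ) (_ : 2 ≤ n) (ε : ℝ) (_ : 0 < ε) (_ : ε < 1),
        (8 * (d : ℝ) * Real.log (12 * (n : ℝ) / min (ε / 2) (1 / (n : ℝ) ^ (1 / 2 + s / (d : ℝ))))
            ≤ r₀ ^ d * (n : ℝ) * b * c * unitBallVolume d / 2 →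
          ENNReal.ofReal (1 - ε) ≤ P (deviationEvent μ M φ X b c L s n ε K₁ K₂)) ∧
        ENNReal.ofReal (1 - ε) ≤ P (deviationEvent μ M φ X b c L s n ε
          (K₁' (Metric.diam M / r₀)) (K₂' (Metric.diam M / r₀))) := by
  obtain ⟨κ, hκ⟩ := exists_card_nearest_le (EuclideanSpace ℝ (Fin d))
  have hV := unitBallVolume_pos d
  have hU : 0 < U := hb.trans_le hbU
  set K := 8 * L * (16 * d / (b * c * unitBallVolume d)) ^ (s / (d : ℝ))
      * (κ + 2 + 16 * d * U / (b * c)) with hK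
  have hK0 : 0 < K := by positivity
  -- The absolute values keep `J` nonnegative at every real `q`, as positivity is claimed for all
  -- arguments.
  let J : ℝ → ℝ := fun q =>
    4 * L * (|q| ^ s * (16 * d / (b * c * unitBallVolume d)) ^ (s / (d : ℝ)))
      * Real.sqrt (U * unitBallVolume d * (|q| ^ d * (16 * d / (b * c * unitBallVolume d))))
  have hJ : ∀ q, 0 ≤ J q := fun q => by positivity
  refine ⟨K, 2 * K, fun q => 2 * K + J q, fun q => 2 * K + J q, hK0, by positivity,
    fun q => by linarith [hJ q], fun q => by linarith [hJ q], ?_⟩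
  intro Ω _ P _ μ _ M f r₀ hr₀ h X hX hind hlaw φ hφ n hn ε hε hε1
  have hJ' := hJ (Metric.diam M / r₀)
  refine ⟨fun hlarge => le_measure_deviationEvent_of_large hd hb hbU hc hL hs hs1 hκ hr₀ h hX hind
    hlaw hφ hn hε hε1 hlarge le_rfl le_rfl, ?_⟩
  rcases le_or_gt (8 * (d : ℝ) * Real.log (12 * (n : ℝ) / min (ε / 2)
      (1 / (n : ℝ) ^ (1 / 2 + s / (d : ℝ))))) (r₀ ^ d * (n : ℝ) * b * c * unitBallVolume d / 2)
    with hlarge | hsmall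
  · exact le_measure_deviationEvent_of_large hd hb hbU hc hL hs hs1 hκ hr₀ h hX hind hlaw hφ hn hε
      hε1 hlarge (by linarith) (by linarith)
  · have hJle : J (Metric.diam M / r₀) ≤ 2 * K + J (Metric.diam M / r₀) := by linarith
    exact le_measure_deviationEvent_of_small hd hb hbU hc hL hs hs1 hr₀ h hX hind hlaw hφ hn hε
      hε1 hsmall rfl hJle hJle
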